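/- All graphs are finite and simple, and are considered up to isomorphism. Let $\rho(G)$ denote the largest eigenvalue of the adjacency matrix of $G$, and let $\mathbb{G}_{n,\alpha}$ be the set of connected graphs of order $n$ with independence number $\alpha$. If $k=n-\alpha$, we also write $\mathbb{G}^k_{n,\alpha}=\mathbb{G}_{n,\alpha}$. A graph in $\mathbb{G}_{n,\alpha}$ is called a *minimizer* if its spectral radius $\rho$ is minimum among all graphs in $\mathbb{G}_{n,\alpha}$. For a graph $T$, a *control vertex* is a vertex $v$ of degree $d(v)\ge 3$ such that at least $d(v)-1$ components of $T-v$ are paths; by convention the vertex of $P_1$ is also a control vertex. A *control path* is a path $v_0v_1\cdots v_q$ ($q\ge 0$) of $T$ whose two ends $v_0,v_q$ are control vertices. Let $V_2^*=V_2^*(T)$ be the set of vertices that occur as $v_i$ with $i$ even on some control path of $T$. For a set $A$ of vertices of $T$ and an integer $l\ge 0$, let $T\circ l\mathbf{1}_A$ be the graph obtained from $T$ by joining each vertex of $A$ to $l$ new pendant vertices. **Theorem 4.1.** Let $1\le k=n-\alpha\le n/2$, let $n+1\equiv r \pmod k$ with $0\le r\le k-1$, let $n_0=3k^2-k-1-(k-1)r$,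 and suppose $n\ge n_0$. Call a graph a *kernel* if it is a minimizer in $\mathbb{G}^k_{n_0,n_0-k}$; when $k=1$, so that $n_0=1$ and $\mathbb{G}_{1,0}$ is empty, the kernel is by convention $P_1$. Then $\ell_{n,k}=(n-n_0)/k$ is an integer, and a graph $T^*$ is a minimizer in $\mathbb{G}^k_{n,\alpha}$ if and only if $$T^*=T_{n_0}\circ \ell_{n,k}\mathbf{1}_{V_2^*}\quad\text{with } V_2^*=V_2^*(T_{n_0})$$ for some kernel $T_{n_0}$. Moreover, whenever $T^*=T_{n_0}\circ \ell_{n,k}\mathbf{1}_{V_2^*}$ for a kernel $T_{n_0}$, one has $$\rho(T^*)=\sqrt{\rho^2(T_{n_0})+\ell_{n,k}}.$$ -/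

import Mathlib

namespace IndepMinimizer

open Classical in
/-- The spectral radius `ρ(G)`: the largest eigenvalue of the adjacency matrix of `G`
(the spectrum is finite, and nonempty when `G` has a vertex, so the supremum is a maximum). -/
noncomputable def rho {V : Type*} [Fintype V] (G : SimpleGraph V) : ℝ :=
  sSup (spectrum ℝ (G.adjMatrix ℝ))

/-- `G` belongs to the class of connected graphs of order `n` with independence number `α`. -/
def InClass {V : Type*} [Fintype V] (n α : ℕ) (G : SimpleGraph V) : Prop :=
  G.Connected ∧ Fintype.card V = n ∧ G.indepNum = α

/-- `T` is a minimizer graph: it lies in the class and attains the minimum spectral radius there.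
(Every graph of order `n` is isomorphic to one with vertex set `Fin n`.) -/
def IsMinimizer {V : Type*} [Fintype V] (n α : ℕ) (T : SimpleGraph V) : Prop :=
  InClass n α T ∧ ∀ G : SimpleGraph (Fin n), InClass n α G → rho T ≤ rho G

/-- The graph `G ∘ l 1_A`: every vertex of `A` is joined to `l` new pendant vertices. -/
def attach {V : Type*} (G : SimpleGraph V) (A : Set V) (l : ℕ) :
    SimpleGraph (V ⊕ (A × Fin l)) where
  Adj
    | Sum.inl u, Sum.inl v => G.Adj u v
    | Sum.inl u, Sum.inr p => u = (p.1 : V)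
    | Sum.inr p, Sum.inl u => u = (p.1 : V)
    | Sum.inr _, Sum.inr _ => False
  symm := ⟨by
    rintro (u | p) (v | q) h
    · exact SimpleGraph.Adj.symm h
    · exact h
    · exact h
    · exact h⟩
  loopless := ⟨by
    rintro (u | p) h
    · exact G.irrefl h
    · exact h⟩

/-- A control vertex: a vertex `v` of degree at least `3` such that at least `d(v) - 1` components
of `T - v` are paths. By convention the vertex of the one-vertex tree is a control vertex. -/
def IsControlVertex {V : Type*} (T : SimpleGraph V) (v : V) : Prop :=
  (∀ w, w = v) ∨
  (3 ≤ (T.neighborSet v).ncard ∧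
    (T.neighborSet v).ncard ≤
      {c : (T.induce {v}ᶜ).ConnectedComponent |
        ∃ m : ℕ, Nonempty (c.toSimpleGraph ≃g SimpleGraph.pathGraph m)}.ncard + 1)

/-- The set `V₂*` of even vertices: those that occur with an even index `i` on some control path
`v₀ v₁ ⋯ v_q`, that is, a path whose two ends are control vertices (`q = 0` is allowed). -/
def evenVertices {V : Type*} (T : SimpleGraph V) : Set V :=
  {x | ∃ a b : V, IsControlVertex T a ∧ IsControlVertex T b ∧
    ∃ p : T.Walk a b, p.IsPath ∧ ∃ i ≤ p.length, Even i ∧ p.getVert i = x}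

/-- The kernels: minimizers among the connected graphs of order `n₀` and independence number
`n₀ - k`. For `k = 1` and `n₀ = 1` that class is empty, and the kernel is the one-vertex graph. -/
def IsKernel (k n₀ : ℕ) (K : SimpleGraph (Fin n₀)) : Prop :=
  (k = 1 ∧ n₀ = 1) ∨ IsMinimizer n₀ (n₀ - k) K

end IndepMinimizer

namespace IndepMinimizer

/-! Let `C` be the complement of a maximum independent set, so that `#C = k` and no edge avoids `C`.
Since `rho G ^ 2` is at least every degree, one good graph in the class bounds all degrees of a
minimizer. A subdivided star with evenly spread pendant vertices has `rho < √(s + 1)` with `s` about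
`n / k` (`exists_inClass_rho_lt`), so every degree of a minimizer is at most `s`.

Counting edges between `C` and its complement then shows that, for `n ≥ n₀`, each vertex of `C` has
at least `l = (n - n₀) / k` pendant neighbours (`card_compl_le_of_degree_le`,
`exists_degree_bound`). An edge inside `C`, or a vertex outside `C` of degree at least 3, leaves one
unit of slack, so that every vertex of `C` has a pendant neighbour. Rotating an edge onto such a
neighbour keeps the class and lowers `rho`, a contradiction. Passing to a spanning tree also keeps
the class, so a minimizer is a tree on `C` with every edge subdivided and pendant vertices attached
at `C` (`IsMinimizer.isSubdividedTree`). For `k ≥ 2` all vertices of `C` have degree at least 3, and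
a longest-path argument recovers `C` as `evenVertices` (`evenVertices_eq`).

On a graph bipartite with respect to `A`, attaching `l` pendant vertices at each vertex of `A` adds
exactly `l` to `rho ^ 2` (`rho_attach`). This is monotone in `rho`, so deleting `l` pendants per
vertex of `C` from a minimizer gives a kernel, and attaching them to a kernel gives a minimizer. -/

open Classical Finset Matrix

/-! ### Perron–Frobenius theory of the adjacency matrix. -/

section Perron

theorem isHermitian_adjMatrix {V : Type*} (G : SimpleGraph V) : (G.adjMatrix ℝ).IsHermitian := by
  rw [Matrix.IsHermitian, Matrix.conjTranspose_eq_transpose_of_trivial]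
  exact SimpleGraph.transpose_adjMatrix G

variable {V : Type*} [Fintype V] {G : SimpleGraph V}

theorem exists_mem_spectrum_eq_rho [Nonempty V] (G : SimpleGraph V) :
    rho G ∈ spectrum ℝ (G.adjMatrix ℝ) ∧ ∀ a ∈ spectrum ℝ (G.adjMatrix ℝ), a ≤ rho G := by
  have h := (isHermitian_adjMatrix G).spectrum_real_eq_range_eigenvalues
  have hf : (spectrum ℝ (G.adjMatrix ℝ)).Finite := by rw [h]; exact Set.finite_range _
  have hne : (spectrum ℝ (G.adjMatrix ℝ)).Nonempty := by rw [h]; exact Set.range_nonempty _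
  exact ⟨hne.csSup_mem hf, fun a ha => le_csSup hf.bddAbove ha⟩

theorem posSemidef_rho_sub [Nonempty V] (G : SimpleGraph V) :
    (algebraMap ℝ (Matrix V V ℝ) (rho G) - G.adjMatrix ℝ).PosSemidef := by
  have hH : (algebraMap ℝ (Matrix V V ℝ) (rho G) - G.adjMatrix ℝ).IsHermitian := by
    refine Matrix.IsHermitian.sub ?_ (isHermitian_adjMatrix G)
    rw [Matrix.algebraMap_eq_diagonal]
    exact Matrix.isHermitian_diagonal _
  rw [hH.posSemidef_iff_eigenvalues_nonneg]
  intro i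
  have hi : hH.eigenvalues i ∈ spectrum ℝ (algebraMap ℝ (Matrix V V ℝ) (rho G) - G.adjMatrix ℝ) := by
    rw [hH.spectrum_real_eq_range_eigenvalues]; exact ⟨i, rfl⟩
  rw [← spectrum.singleton_sub_eq] at hi
  obtain ⟨a, ha, b, hb, hab⟩ := hi
  rw [Set.mem_singleton_iff] at ha
  have := (exists_mem_spectrum_eq_rho G).2 b hb
  simp only [Pi.zero_apply]
  rw [← hab, ha]
  simpa using this

/-- Replacing an eigenvector `z` for `rho G` by `|z|` makes the quadratic form of the positive
semidefinite matrix `rho G - A` nonpositive, hence zero; so `|z|` lies in its kernel. -/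
theorem exists_nonneg_eigenvector [Nonempty V] (G : SimpleGraph V) :
    ∃ x : V → ℝ, (∀ v, 0 ≤ x v) ∧ (∃ v, x v ≠ 0) ∧
      ∀ v, ∑ u ∈ G.neighborFinset v, x u = rho G * x v := by
  have hev : Module.End.HasEigenvalue (Matrix.toLin' (G.adjMatrix ℝ)) (rho G) := by
    rw [Module.End.hasEigenvalue_iff_mem_spectrum, Matrix.spectrum_toLin']
    exact (exists_mem_spectrum_eq_rho G).1
  obtain ⟨z, hz⟩ := hev.exists_hasEigenvector
  have hz0 := hz.2
  have hz1 : G.adjMatrix ℝ *ᵥ z = rho G • z := by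
    have := hz.apply_eq_smul
    rwa [Matrix.toLin'_apply] at this
  have hz2 : ∀ v, ∑ u ∈ G.neighborFinset v, z u = rho G * z v := by
    intro v
    have := congrFun hz1 v
    rwa [SimpleGraph.adjMatrix_mulVec_apply] at this
  have hP := posSemidef_rho_sub G
  have hM : ∀ y : V → ℝ, (algebraMap ℝ (Matrix V V ℝ) (rho G) - G.adjMatrix ℝ) *ᵥ y =
      fun v => rho G * y v - ∑ u ∈ G.neighborFinset v, y u := by
    intro y
    ext v
    rw [Matrix.sub_mulVec, Pi.sub_apply, SimpleGraph.adjMatrix_mulVec_apply,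
      Matrix.algebraMap_eq_diagonal, Matrix.mulVec_diagonal]
    rfl
  have hnn := hP.dotProduct_mulVec_nonneg (fun v => |z v|)
  have hle : star (fun v => |z v|) ⬝ᵥ
      ((algebraMap ℝ (Matrix V V ℝ) (rho G) - G.adjMatrix ℝ) *ᵥ (fun v => |z v|)) ≤ 0 := by
    rw [hM]
    simp only [dotProduct, star_trivial]
    refine Finset.sum_nonpos fun v _ => ?_
    have h1 : |∑ u ∈ G.neighborFinset v, z u| ≤ ∑ u ∈ G.neighborFinset v, |z u| :=
      Finset.abs_sum_le_sum_abs _ _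
    rw [hz2, abs_mul] at h1
    have h2 : rho G * |z v| ≤ |rho G| * |z v| :=
      mul_le_mul_of_nonneg_right (le_abs_self _) (abs_nonneg _)
    exact mul_nonpos_of_nonneg_of_nonpos (abs_nonneg _) (by linarith)
  have h0 := (hP.dotProduct_mulVec_zero_iff (fun v => |z v|)).1 (le_antisymm hle hnn)
  rw [hM] at h0
  refine ⟨fun v => |z v|, fun v => abs_nonneg _, ?_, fun v => ?_⟩
  · by_contra! h
    exact hz0 (funext fun v => abs_eq_zero.1 (h v))
  · have := congrFun h0 v
    simp only [Pi.zero_apply] at this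
    linarith

theorem rho_nonneg [Nonempty V] (G : SimpleGraph V) : 0 ≤ rho G := by
  obtain ⟨x, hx, ⟨v, hv⟩, he⟩ := exists_nonneg_eigenvector G
  have h1 : 0 ≤ rho G * x v := by rw [← he]; exact Finset.sum_nonneg fun u _ => hx u
  exact nonneg_of_mul_nonneg_left h1 (lt_of_le_of_ne (hx v) (Ne.symm hv))

/-- Perron–Frobenius for connected graphs. -/
theorem exists_pos_eigenvector (hG : G.Connected) :
    ∃ x : V → ℝ, (∀ v, 0 < x v) ∧ ∀ v, ∑ u ∈ G.neighborFinset v, x u = rho G * x v := by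
  have := hG.nonempty
  obtain ⟨x, hx, ⟨w, hw⟩, he⟩ := exists_nonneg_eigenvector G
  refine ⟨x, fun v => lt_of_le_of_ne (hx v) fun h0 => hw ?_, he⟩
  have key : ∀ a b, G.Adj a b → x a = 0 → x b = 0 := by
    intro a b hab ha
    have := he a
    rw [ha, mul_zero, Finset.sum_eq_zero_iff_of_nonneg fun u _ => hx u] at this
    exact this b (by simpa using hab)
  obtain ⟨p⟩ := hG.preconnected v w
  have : ∀ {a b : V}, G.Walk a b → x a = 0 → x b = 0 := by
    intro a b p
    induction p with
    | nil => exact id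
    | cons h _ ih => exact fun ha => ih (key _ _ h ha)
  exact this p h0.symm

theorem sum_mul_sum_neighborFinset (G : SimpleGraph V) (x y : V → ℝ) :
    ∑ v, x v * ∑ u ∈ G.neighborFinset v, y u = ∑ v, y v * ∑ u ∈ G.neighborFinset v, x u := by
  have h : ∀ a b : V → ℝ, ∑ v, a v * ∑ u ∈ G.neighborFinset v, b u =
      ∑ v, ∑ u, if G.Adj v u then a v * b u else 0 := by
    intro a b
    refine Finset.sum_congr rfl fun v _ => ?_
    rw [Finset.mul_sum, ← Finset.sum_filter]
    refine Finset.sum_congr ?_ fun _ _ => rfl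
    ext; simp
  rw [h, h, Finset.sum_comm]
  refine Finset.sum_congr rfl fun v _ => Finset.sum_congr rfl fun u _ => ?_
  simp only [G.adj_comm u v, mul_comm (x u)]

/-- The Collatz–Wielandt upper bound, in its strict form for connected graphs. -/
theorem rho_lt_of_forall_le (hG : G.Connected) {y : V → ℝ} {μ : ℝ} (hy : ∀ v, 0 < y v)
    (h : ∀ v, ∑ u ∈ G.neighborFinset v, y u ≤ μ * y v)
    (hlt : ∃ v, ∑ u ∈ G.neighborFinset v, y u < μ * y v) : rho G < μ := by
  obtain ⟨x, hx, he⟩ := exists_pos_eigenvector hG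
  obtain ⟨w, hw⟩ := hlt
  have h1 := sum_mul_sum_neighborFinset G x y
  simp only [he] at h1
  have h2 : ∑ v, x v * ∑ u ∈ G.neighborFinset v, y u < ∑ v, x v * (μ * y v) :=
    Finset.sum_lt_sum (fun v _ => mul_le_mul_of_nonneg_left (h v) (hx v).le)
      ⟨w, Finset.mem_univ _, mul_lt_mul_of_pos_left hw (hx w)⟩
  have h3 : ∑ v, y v * (rho G * x v) = rho G * ∑ v, x v * y v := by
    rw [Finset.mul_sum]; exact Finset.sum_congr rfl fun v _ => by ring
  have h4 : ∑ v, x v * (μ * y v) = μ * ∑ v, x v * y v := by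
    rw [Finset.mul_sum]; exact Finset.sum_congr rfl fun v _ => by ring
  have h5 : 0 < ∑ v, x v * y v :=
    Finset.sum_pos (fun v _ => mul_pos (hx v) (hy v)) ⟨w, Finset.mem_univ _⟩
  rw [h1, h3, h4] at h2
  exact lt_of_mul_lt_mul_right h2 h5.le

theorem rho_eq_of_pos_eigenvector [Nonempty V] {y : V → ℝ} {μ : ℝ} (hy : ∀ v, 0 < y v)
    (h : ∀ v, ∑ u ∈ G.neighborFinset v, y u = μ * y v) : rho G = μ := by
  obtain ⟨x, hx, ⟨w, hw⟩, he⟩ := exists_nonneg_eigenvector G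
  have h1 := sum_mul_sum_neighborFinset G x y
  simp only [he, h] at h1
  have h3 : ∑ v, y v * (rho G * x v) = rho G * ∑ v, x v * y v := by
    rw [Finset.mul_sum]; exact Finset.sum_congr rfl fun v _ => by ring
  have h4 : ∑ v, x v * (μ * y v) = μ * ∑ v, x v * y v := by
    rw [Finset.mul_sum]; exact Finset.sum_congr rfl fun v _ => by ring
  have h5 : 0 < ∑ v, x v * y v :=
    Finset.sum_pos' (fun v _ => mul_nonneg (hx v) (hy v).le)
      ⟨w, Finset.mem_univ _, mul_pos (lt_of_le_of_ne (hx w) (Ne.symm hw)) (hy w)⟩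
  rw [h3, h4] at h1
  exact (mul_right_cancel₀ h5.ne' h1).symm

theorem rho_lt_of_lt {H : SimpleGraph V} (hG : G.Connected) (hH : H.Connected) (h : H < G) :
    rho H < rho G := by
  obtain ⟨x, hx, he⟩ := exists_pos_eigenvector hG
  have hsub : ∀ v, H.neighborFinset v ⊆ G.neighborFinset v := by
    intro v u hu
    simp only [SimpleGraph.mem_neighborFinset] at hu ⊢
    exact h.le hu
  refine rho_lt_of_forall_le hH hx (fun v => ?_) ?_
  · rw [← he]
    exact Finset.sum_le_sum_of_subset_of_nonneg (hsub v) fun u _ _ => (hx u).le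
  · obtain ⟨a, b, hab, hn⟩ : ∃ a b, G.Adj a b ∧ ¬ H.Adj a b := by
      by_contra! hc
      exact h.not_ge hc
    refine ⟨a, ?_⟩
    rw [← he]
    exact Finset.sum_lt_sum_of_subset (hsub a) (i := b) (by simpa using hab) (by simpa using hn)
      (hx b) fun u _ _ => (hx u).le

/-- Each neighbour `u` of `v` satisfies `x v ≤ rho G * x u`; summing over the neighbours gives `d(v)
x v ≤ rho G ^ 2 * x v`. -/
theorem degree_le_rho_sq (hG : G.Connected) (v : V) : (G.degree v : ℝ) ≤ rho G ^ 2 := by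
  obtain ⟨x, hx, he⟩ := exists_pos_eigenvector hG
  have h1 : ∀ u ∈ G.neighborFinset v, x v ≤ rho G * x u := by
    intro u hu
    rw [← he]
    exact Finset.single_le_sum (fun w _ => (hx w).le)
      (by simpa using (G.mem_neighborFinset v u).1 hu |>.symm)
  have h2 := Finset.sum_le_sum h1
  rw [Finset.sum_const, nsmul_eq_mul, SimpleGraph.card_neighborFinset_eq_degree, ← Finset.mul_sum,
    he] at h2
  have h3 : (G.degree v : ℝ) * x v ≤ rho G ^ 2 * x v := by nlinarith
  exact le_of_mul_le_mul_right h3 (hx v)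

theorem rho_congr {W : Type*} [Fintype W] {H : SimpleGraph W} (e : G ≃g H) : rho G = rho H := by
  have h : H.adjMatrix ℝ = Matrix.reindexAlgEquiv ℝ ℝ e.toEquiv (G.adjMatrix ℝ) := by
    ext i j
    simp only [Matrix.coe_reindexAlgEquiv, Matrix.reindex_apply, Matrix.submatrix_apply,
      SimpleGraph.adjMatrix_apply]
    have : G.Adj (e.toEquiv.symm i) (e.toEquiv.symm j) ↔ H.Adj i j := e.symm.map_rel_iff
    simp only [this]
  rw [rho, rho, h, AlgEquiv.spectrum_eq]

end Perron

/-! ### Invariance of the class under isomorphism, and independence numbers from matchings. -/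

section Class

theorem indepNum_le_of_iso {V W : Type*} [Finite V] [Fintype W] {G : SimpleGraph V}
    {H : SimpleGraph W} (e : G ≃g H) : G.indepNum ≤ H.indepNum := by
  obtain ⟨s, hs⟩ := G.exists_isNIndepSet_indepNum
  have h : H.IsIndepSet (s.map e.toEquiv.toEmbedding : Finset W) := by
    intro a ha b hb hab hadj
    simp only [Finset.coe_map, Set.mem_image, Finset.mem_coe] at ha hb
    obtain ⟨a, ha, rfl⟩ := ha
    obtain ⟨b, hb, rfl⟩ := hb
    exact hs.isIndepSet ha hb (fun h => hab (by rw [h])) (e.map_rel_iff.1 hadj)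
  have := h.card_le_indepNum
  rwa [Finset.card_map, hs.card_eq] at this

variable {V W : Type*} [Fintype V] [Fintype W] {G : SimpleGraph V} {n α : ℕ}

theorem InClass.congr {H : SimpleGraph W} (e : G ≃g H) (h : InClass n α G) : InClass n α H :=
  ⟨e.connected_iff.1 h.1, (Fintype.card_congr e.toEquiv).symm.trans h.2.1,
    (le_antisymm (indepNum_le_of_iso e.symm) (indepNum_le_of_iso e)).trans h.2.2⟩

theorem IsMinimizer.le_rho {T : SimpleGraph V} (hT : IsMinimizer n α T) {H : SimpleGraph W}
    (h : InClass n α H) : rho T ≤ rho H := by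
  have e := H.overFinIso h.2.1
  rw [rho_congr e]
  exact hT.2 _ (h.congr e)

theorem exists_isMinimizer (h : InClass n α G) : ∃ T : SimpleGraph (Fin n), IsMinimizer n α T := by
  have hne : {H : SimpleGraph (Fin n) | InClass n α H}.Nonempty :=
    ⟨_, h.congr (G.overFinIso h.2.1)⟩
  obtain ⟨T, hT, hm⟩ := Set.exists_min_image _ rho (Set.toFinite _) hne
  exact ⟨T, hT, hm⟩

/-- König-type argument: `f` is a matching that saturates `C`, so in any independent set the
vertices of `C` can be exchanged for their partners outside `C` without collisions. -/
theorem indepNum_eq_of_injOn {C : Finset V} (hI : ∀ u ∉ C, ∀ v ∉ C, ¬ G.Adj u v) (f : V → V)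
    (hf : Set.InjOn f C) (hfC : ∀ v ∈ C, f v ∉ C) (hfa : ∀ v ∈ C, G.Adj v (f v)) :
    G.indepNum = Fintype.card V - #C := by
  rw [← Finset.card_compl]
  refine le_antisymm ?_ ?_
  · obtain ⟨s, hs⟩ := G.exists_isNIndepSet_indepNum
    rw [← hs.card_eq]
    have h1 : #(s ∩ C) + #(s \ C) = #s := Finset.card_inter_add_card_sdiff s C
    have h2 : #((s ∩ C).image f) = #(s ∩ C) :=
      Finset.card_image_of_injOn (hf.mono fun x hx => by simp at hx; exact hx.2)
    have h3 : Disjoint ((s ∩ C).image f) (s \ C) := by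
      rw [Finset.disjoint_left]
      rintro _ hx hy
      obtain ⟨x, hxs, rfl⟩ := Finset.mem_image.1 hx
      have hx' := Finset.mem_inter.1 hxs
      exact hs.isIndepSet hx'.1 (Finset.mem_sdiff.1 hy).1 (hfa x hx'.2).ne (hfa x hx'.2)
    have h4 : (s ∩ C).image f ∪ s \ C ⊆ Cᶜ := by
      intro y hy
      rw [Finset.mem_compl]
      rcases Finset.mem_union.1 hy with hy | hy
      · obtain ⟨x, hx, rfl⟩ := Finset.mem_image.1 hy
        exact hfC x (Finset.mem_inter.1 hx).2
      · exact (Finset.mem_sdiff.1 hy).2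
    have h5 := Finset.card_le_card h4
    rw [Finset.card_union_of_disjoint h3, h2] at h5
    omega
  · refine SimpleGraph.IsIndepSet.card_le_indepNum ?_
    intro a ha b hb _
    exact hI a (by simpa using ha) b (by simpa using hb)

/-- A connected graph that arises from a multigraph on `C` by subdividing every edge once and
attaching pendant vertices has a matching that saturates `C`, if it has a pendant vertex. -/
theorem indepNum_eq_of_degree_le_two {C : Finset V} (hG : G.Connected)
    (hbip : ∀ u v, G.Adj u v → (u ∈ C ↔ v ∉ C)) (hdeg : ∀ i ∉ C, G.degree i ≤ 2)
    (hpend : ∃ i ∉ C, G.degree i = 1) : G.indepNum = Fintype.card V - #C := by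
  obtain ⟨i, hiC, hi⟩ := hpend
  obtain ⟨u, hu⟩ := Finset.card_eq_one.1 hi
  have hiu : ∀ w, G.Adj i w ↔ w = u := fun w => by
    rw [← SimpleGraph.mem_neighborFinset, hu, Finset.mem_singleton]
  -- The matching sends `u` to the pendant vertex `i` and any other vertex of `C` to a neighbour one
  -- step closer to `u`.
  have step : ∀ v, v ≠ u → ∃ w, G.Adj v w ∧ G.dist w u < G.dist v u := by
    intro v hv
    obtain ⟨p, hp⟩ := hG.exists_walk_length_eq_dist v u
    cases p with
    | nil => exact absurd rfl hv
    | cons h q =>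
      refine ⟨_, h, ?_⟩
      have := SimpleGraph.dist_le q
      rw [SimpleGraph.Walk.length_cons] at hp
      omega
  choose! g hg using step
  have huC : u ∈ C := by
    have := hbip i u ((hiu u).2 rfl)
    tauto
  refine indepNum_eq_of_injOn (fun a ha b hb hab => ?_) (fun v => if v = u then i else g v)
    ?_ ?_ ?_
  · have := hbip a b hab
    tauto
  · intro a ha b hb hab
    by_contra hne
    simp only at hab
    split_ifs at hab with h1 h2 h2
    · exact hne (h1.trans h2.symm)
    · have := (hg b h2).1.symm
      rw [← hab, hiu] at this
      exact h2 this
    · have := (hg a h1).1.symm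
      rw [hab, hiu] at this
      exact h1 this
    · obtain ⟨a1, a2⟩ := hg a h1
      obtain ⟨b1, b2⟩ := hg b h2
      rw [← hab] at b1 b2
      have hwC : g a ∉ C := (hbip _ _ a1).1 ha
      have hwu : g a ≠ u := fun h => hwC (h ▸ huC)
      obtain ⟨c1, c2⟩ := hg _ hwu
      -- If `a` and `b` share the partner `g a`, this partner also has a neighbour closer to `u`,
      -- hence three neighbours.
      have h3 : ({a, b, g (g a)} : Finset V) ⊆ G.neighborFinset (g a) := by
        intro x hx
        rw [SimpleGraph.mem_neighborFinset]
        simp only [Finset.mem_insert, Finset.mem_singleton] at hx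
        rcases hx with rfl | rfl | rfl
        · exact a1.symm
        · exact b1.symm
        · exact c1
      have h4 := Finset.card_le_card h3
      rw [Finset.card_eq_three.2 ⟨a, b, g (g a), hne, fun h => by rw [← h] at c2; omega,
        fun h => by rw [← h] at c2; omega, rfl⟩, SimpleGraph.card_neighborFinset_eq_degree] at h4
      have := hdeg _ hwC
      omega
  · intro v hv
    split_ifs with h
    · exact hiC
    · exact (hbip _ _ (hg v h).1).1 hv
  · intro v hv
    split_ifs with h
    · rw [h]; exact ((hiu u).2 rfl).symm
    · exact (hg v h).1

end Class

/-! ### A comparison graph with small spectral radius. -/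

section SubdividedStar

theorem sum_neighborFinset_eq_sum_ite {V : Type*} [Fintype V] (G : SimpleGraph V) (y : V → ℝ)
    (v : V) : ∑ u ∈ G.neighborFinset v, y u = ∑ u, if G.Adj v u then y u else 0 := by
  rw [← Finset.sum_filter]
  refine Finset.sum_congr ?_ fun _ _ => rfl
  ext; simp

/-- The star `K_{1,m}` with every edge subdivided once, with centre `0` and leaves `j.succ`, where
`p v` pendant vertices are attached to each vertex `v` of the star. -/
def subdividedStar (m : ℕ) (p : Fin (m + 1) → ℕ) :
    SimpleGraph (Fin (m + 1) ⊕ (Fin m ⊕ Σ v, Fin (p v))) where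
  Adj
    | Sum.inl v, Sum.inr (Sum.inl j) => v = 0 ∨ v = j.succ
    | Sum.inr (Sum.inl j), Sum.inl v => v = 0 ∨ v = j.succ
    | Sum.inl v, Sum.inr (Sum.inr x) => v = x.1
    | Sum.inr (Sum.inr x), Sum.inl v => v = x.1
    | Sum.inl _, Sum.inl _ => False
    | Sum.inr _, Sum.inr _ => False
  symm := ⟨by rintro (u | i | x) (v | j | y) h <;> exact h⟩
  loopless := ⟨by rintro (u | i | x) h <;> exact h⟩

variable {m : ℕ} {p : Fin (m + 1) → ℕ}

theorem subdividedStar_connected : (subdividedStar m p).Connected := by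
  have h0 : ∀ j : Fin m, (subdividedStar m p).Reachable (Sum.inr (Sum.inl j)) (Sum.inl 0) :=
    fun j => SimpleGraph.Adj.reachable (Or.inl rfl)
  have h1 : ∀ v, (subdividedStar m p).Reachable (Sum.inl v) (Sum.inl 0) := by
    intro v
    refine Fin.cases ?_ (fun j => ?_) v
    · exact SimpleGraph.Reachable.refl _
    · refine SimpleGraph.Reachable.trans (SimpleGraph.Adj.reachable ?_) (h0 j)
      exact Or.inr rfl
  have h2 : ∀ x, (subdividedStar m p).Reachable x (Sum.inl 0) := by
    rintro (v | j | ⟨v, x⟩)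
    · exact h1 v
    · exact h0 j
    · refine SimpleGraph.Reachable.trans (SimpleGraph.Adj.reachable ?_) (h1 v)
      exact rfl
  exact { preconnected := fun x y => (h2 x).trans (h2 y).symm, nonempty := ⟨Sum.inl 0⟩ }

theorem subdividedStar_indepNum (hp : ∀ v, 1 ≤ p v) :
    (subdividedStar m p).indepNum = m + ∑ v, p v := by
  have h := indepNum_eq_of_injOn (G := subdividedStar m p)
    (C := univ.map ⟨Sum.inl, Sum.inl_injective⟩) ?_
    (fun x => match x with
      | Sum.inl v => Sum.inr (Sum.inr ⟨v, ⟨0, hp v⟩⟩)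
      | Sum.inr y => Sum.inr y) ?_ ?_ ?_
  · rw [h, Finset.card_map]
    simp
  · rintro (u | u) hu (v | v) hv h
    · simp at hu
    · simp at hu
    · simp at hv
    · rcases u with u | u <;> rcases v with v | v <;> exact h
  · rintro (u | u) hu (v | v) hv h
    · simp only [Sum.inr.injEq, Sigma.mk.injEq] at h
      rw [h.1]
    all_goals simp at hu hv
  · rintro (u | u) hu <;> simp at hu ⊢
  · rintro (u | u) hu
    · exact rfl
    · simp at hu

theorem rho_subdividedStar_lt {s : ℕ} (h0 : 2 * m + p 0 ≤ s)
    (hs : ∀ j : Fin m, 2 + p j.succ ≤ s + 1) :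
    rho (subdividedStar m p) < √(s + 1) := by
  have hs0 : (0 : ℝ) < s + 1 := by positivity
  have hsq := Real.mul_self_sqrt hs0.le
  have hpos := Real.sqrt_pos.2 hs0
  have hc0 : (2 : ℝ) * m + p 0 ≤ s := by exact_mod_cast h0
  have hcs : ∀ j : Fin m, (2 : ℝ) + p j.succ ≤ s + 1 := fun j => by exact_mod_cast hs j
  -- Test vector for eigenvalue `√(s + 1)`: tight at the vertices outside the star's own `m + 1`
  -- vertices, and strict at the centre.
  set y : Fin (m + 1) ⊕ (Fin m ⊕ Σ v, Fin (p v)) → ℝ :=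
    Sum.elim (fun _ => √(s + 1)) (Sum.elim (fun _ => 2) fun _ => 1) with hy
  have hrow : ∀ v, ∑ u ∈ (subdividedStar m p).neighborFinset (Sum.inl v), y u =
      (∑ j : Fin m, if v = 0 ∨ v = j.succ then (2 : ℝ) else 0) + p v := by
    intro v
    rw [sum_neighborFinset_eq_sum_ite, Fintype.sum_sum_type, Fintype.sum_sum_type,
      Fintype.sum_sigma]
    have : ∀ a b, (subdividedStar m p).Adj (Sum.inl a) (Sum.inl b) ↔ False := fun _ _ => Iff.rfl
    have h2 : ∀ a b, (subdividedStar m p).Adj (Sum.inl a) (Sum.inr (Sum.inl b)) ↔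
      (a = 0 ∨ a = b.succ) := fun _ _ => Iff.rfl
    have h3 : ∀ a b, (subdividedStar m p).Adj (Sum.inl a) (Sum.inr (Sum.inr b)) ↔ a = b.1 :=
      fun _ _ => Iff.rfl
    simp [this, h2, h3, hy]
  have hrow0 : ∑ u ∈ (subdividedStar m p).neighborFinset (Sum.inl 0), y u = 2 * m + p 0 := by
    rw [hrow]; simp [mul_comm]
  refine rho_lt_of_forall_le (y := y) subdividedStar_connected ?_ ?_ ⟨Sum.inl 0, ?_⟩
  · rintro (v | j | x)
    · exact hpos
    · simp [hy]
    · simp [hy]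
  · rintro (v | j | x)
    · refine Fin.cases ?_ (fun j => ?_) v
      · rw [hrow0]
        simp only [hy, Sum.elim_inl]
        linarith
      · rw [hrow]
        simp only [hy, Sum.elim_inl, Fin.succ_ne_zero, false_or, Fin.succ_inj]
        rw [Finset.sum_ite_eq, if_pos (Finset.mem_univ _)]
        have := hcs j
        linarith
    · rw [sum_neighborFinset_eq_sum_ite, Fintype.sum_sum_type]
      have h2 : ∀ b, (subdividedStar m p).Adj (Sum.inr (Sum.inl j)) (Sum.inl b) ↔
        (b = 0 ∨ b = j.succ) := fun _ => Iff.rfl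
      have h3 : ∀ b, (subdividedStar m p).Adj (Sum.inr (Sum.inl j)) (Sum.inr b) ↔ False :=
        fun _ => Iff.rfl
      simp only [h2, h3, hy, Fin.sum_univ_succ, Sum.elim_inl, Sum.elim_inr]
      simp only [true_or, if_true, Fin.succ_ne_zero, false_or, Fin.succ_inj, if_false,
        Finset.sum_const_zero, add_zero]
      rw [Finset.sum_ite_eq', if_pos (Finset.mem_univ _)]
      linarith
    · rw [sum_neighborFinset_eq_sum_ite, Fintype.sum_sum_type]
      have h2 : ∀ b, (subdividedStar m p).Adj (Sum.inr (Sum.inr x)) (Sum.inl b) ↔ b = x.1 :=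
        fun _ => Iff.rfl
      have h3 : ∀ b, (subdividedStar m p).Adj (Sum.inr (Sum.inr x)) (Sum.inr b) ↔ False :=
        fun _ => Iff.rfl
      simp [h2, h3, hy]
  · rw [hrow0]
    simp only [hy, Sum.elim_inl]
    linarith

/-- The pendant vertices are distributed so that the row sums at the `k` star vertices are `s` at
the centre and `s` or `s + 1` at the leaves; the remainder `t` counts the leaves with `s + 1`. The
bound `2 * k ≤ s + 1` leaves the centre at least one pendant vertex. -/
theorem exists_inClass_rho_lt {n k s t : ℕ} (hk : 1 ≤ k) (hst : k * s + t + 3 = n + 2 * k)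
    (ht : t < k) (hs : 2 * k ≤ s + 1) :
    ∃ G : SimpleGraph (Fin n), InClass n (n - k) G ∧ rho G < √(s + 1) := by
  obtain ⟨m, rfl⟩ : ∃ m, k = m + 1 := ⟨k - 1, by omega⟩
  set p : Fin (m + 1) → ℕ := Fin.cons (s - 2 * m) fun j : Fin m => (s - 2) + if (j : ℕ) < t then 1 else 0
    with hp
  have hp0 : p 0 = s - 2 * m := rfl
  have hps : ∀ j : Fin m, p j.succ = (s - 2) + if (j : ℕ) < t then 1 else 0 := fun j => rfl
  have hsum : ∑ v, p v = s - 2 * m + (m * (s - 2) + t) := by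
    rw [Fin.sum_univ_succ, hp0]
    simp only [hps, Finset.sum_add_distrib, Finset.sum_const, Finset.card_univ, Fintype.card_fin,
      smul_eq_mul]
    congr 2
    rw [← Finset.card_filter, Fin.card_filter_val_lt]
    omega
  have hpos : ∀ v, 1 ≤ p v := by
    intro v
    refine Fin.cases ?_ (fun j => ?_) v
    · rw [hp0]; omega
    · have := j.2
      rw [hps]; omega
  have hn : 2 * m + 1 + ∑ v, p v = n := by
    rw [hsum]
    rcases Nat.eq_zero_or_pos m with rfl | hm
    · omega
    · obtain ⟨c, rfl⟩ : ∃ c, s = c + 2 := ⟨s - 2, by omega⟩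
      have : (m + 1) * (c + 2) = m * c + 2 * m + c + 2 := by ring
      rw [Nat.add_sub_cancel]
      omega
  have hcl : InClass n (n - (m + 1)) (subdividedStar m p) := by
    refine ⟨subdividedStar_connected, ?_, ?_⟩
    · simp; omega
    · rw [subdividedStar_indepNum hpos]; omega
  have e := (subdividedStar m p).overFinIso hcl.2.1
  refine ⟨_, hcl.congr e, ?_⟩
  rw [← rho_congr e]
  refine rho_subdividedStar_lt (by rw [hp0]; omega) fun j => ?_
  have := j.2
  rw [hps]
  split_ifs <;> omega

end SubdividedStar

/-! ### Edge rotations that decrease the spectral radius. -/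

section Rotation

/-- The graph obtained from `G` by replacing the edge `xc` with the edge `pc`. -/
def rotate {V : Type*} (G : SimpleGraph V) (x p c : V) : SimpleGraph V where
  Adj u v := u ≠ v ∧ ((G.Adj u v ∧ ¬ (u = x ∧ v = c) ∧ ¬ (u = c ∧ v = x)) ∨
    (u = p ∧ v = c) ∨ (u = c ∧ v = p))
  symm := ⟨fun u v h => by
    have := G.adj_comm u v
    tauto⟩
  loopless := ⟨fun u h => h.1 rfl⟩

variable {V : Type*} {G : SimpleGraph V} {x p b c : V}

/-- If `p` is a pendant vertex at `b`, where `b` is equal or adjacent to `x`, then replacing the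
edge `xc` with `pc` keeps the graph connected. -/
theorem rotate_connected (hG : G.Connected) (hp : ∀ w, G.Adj p w ↔ w = b) (hbc : b ≠ c)
    (hpc : p ≠ c) (hxc : G.Adj x c) (hx : x = b ∨ G.Adj x b) : (rotate G x p c).Connected := by
  have hpb : G.Adj p b := (hp b).2 rfl
  have hpx : p ≠ x := fun h => hbc ((hp c).1 (h ▸ hxc)).symm
  have h1 : (rotate G x p c).Reachable x b := by
    rcases hx with rfl | hx
    · exact SimpleGraph.Reachable.refl _
    · refine SimpleGraph.Adj.reachable ⟨hx.ne, Or.inl ⟨hx, fun h => hbc h.2, fun h => ?_⟩⟩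
      exact hxc.ne h.1
  have h2 : (rotate G x p c).Reachable b p := by
    refine SimpleGraph.Adj.reachable ⟨hpb.ne.symm, Or.inl ⟨hpb.symm, fun h => ?_, fun h => ?_⟩⟩
    · exact hpc h.2
    · exact hbc h.1
  have h3 : (rotate G x p c).Reachable p c :=
    SimpleGraph.Adj.reachable ⟨hpc, Or.inr (Or.inl ⟨rfl, rfl⟩)⟩
  have hxc' : (rotate G x p c).Reachable x c := (h1.trans h2).trans h3
  have hadj : ∀ u v, G.Adj u v → (rotate G x p c).Reachable u v := by
    intro u v huv
    by_cases h : u = x ∧ v = c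
    · rw [h.1, h.2]; exact hxc'
    by_cases h' : u = c ∧ v = x
    · rw [h'.1, h'.2]; exact hxc'.symm
    exact SimpleGraph.Adj.reachable ⟨huv.ne, Or.inl ⟨huv, h, h'⟩⟩
  have hwalk : ∀ u v, G.Walk u v → (rotate G x p c).Reachable u v := by
    intro u v w
    induction w with
    | nil => exact SimpleGraph.Reachable.refl _
    | cons h _ ih => exact (hadj _ _ h).trans ih
  exact { preconnected := fun u v => (hG.preconnected u v).elim (hwalk u v), nonempty := hG.nonempty }

variable [Fintype V]

theorem sum_neighborFinset_rotate (hxc : G.Adj x c) (hpc : ¬ G.Adj p c) (hne : p ≠ c)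
    (hpx : p ≠ x) (y : V → ℝ) (v : V) :
    ∑ u ∈ (rotate G x p c).neighborFinset v, y u = ∑ u ∈ G.neighborFinset v, y u +
      ((if v = x then - y c else 0) + (if v = c then y p - y x else 0) +
        if v = p then y c else 0) := by
  have hxc' := hxc.ne
  by_cases hvx : v = x
  · subst hvx
    rw [if_pos rfl, if_neg hxc', if_neg hpx.symm]
    have : (rotate G v p c).neighborFinset v = (G.neighborFinset v).erase c := by
      ext u
      simp only [SimpleGraph.mem_neighborFinset, Finset.mem_erase]
      simp only [rotate]
      have : G.Adj v u → v ≠ u := SimpleGraph.Adj.ne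
      have := hpx.symm
      tauto
    rw [this, Finset.sum_erase_eq_sub (by simpa using hxc)]
    ring
  by_cases hvc : v = c
  · subst hvc
    rw [if_neg hvx, if_pos rfl, if_neg hne.symm]
    have : (rotate G x p v).neighborFinset v = insert p ((G.neighborFinset v).erase x) := by
      ext u
      simp only [SimpleGraph.mem_neighborFinset, Finset.mem_erase, Finset.mem_insert]
      simp only [rotate]
      have : G.Adj v u → v ≠ u := SimpleGraph.Adj.ne
      have h3 : u = p → v ≠ u := fun h => h ▸ hne.symm
      tauto
    rw [this, Finset.sum_insert (by simp [hpx, G.adj_comm v p, hpc]),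
      Finset.sum_erase_eq_sub (by simpa using hxc.symm)]
    ring
  by_cases hvp : v = p
  · subst hvp
    rw [if_neg hvx, if_neg hvc, if_pos rfl]
    have : (rotate G x v c).neighborFinset v = insert c (G.neighborFinset v) := by
      ext u
      simp only [SimpleGraph.mem_neighborFinset, Finset.mem_insert]
      simp only [rotate]
      have : G.Adj v u → v ≠ u := SimpleGraph.Adj.ne
      have h3 : u = c → v ≠ u := fun h => h ▸ hne
      tauto
    rw [this, Finset.sum_insert (by simpa using hpc)]
    ring
  · rw [if_neg hvx, if_neg hvc, if_neg hvp]
    have : (rotate G x p c).neighborFinset v = G.neighborFinset v := by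
      ext u
      simp only [SimpleGraph.mem_neighborFinset]
      simp only [rotate]
      have : G.Adj v u → v ≠ u := SimpleGraph.Adj.ne
      tauto
    rw [this]
    ring

/-- Rotating the edge `bc` to a pendant vertex `p` of `b` (that is, subdividing `bc` by means of
`p`) decreases the spectral radius, if `b` has the larger entry in the Perron vector. -/
theorem rho_rotate_lt_of_adj (hG : G.Connected) (hp : ∀ w, G.Adj p w ↔ w = b) (hpc : p ≠ c)
    (hbc : G.Adj b c) (hρ : 2 ≤ rho G) {z : V → ℝ} (hz : ∀ v, 0 < z v)
    (he : ∀ v, ∑ u ∈ G.neighborFinset v, z u = rho G * z v) (hcb : z c ≤ z b) :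
    rho (rotate G b p c) < rho G := by
  have hρ0 : 0 < rho G := by linarith
  have hpb : p ≠ b := ((hp b).2 rfl).ne
  have hpc' : ¬ G.Adj p c := fun h => hbc.ne ((hp c).1 h).symm
  have hpz : rho G * z p = z b := by
    rw [← he, show G.neighborFinset p = {b} by ext; simp [hp], Finset.sum_singleton]
  set δ := z c / rho G with hδ
  have hδ0 : 0 < δ := div_pos (hz c) hρ0
  have hδρ : rho G * δ = z c := mul_div_cancel₀ _ hρ0.ne'
  set y : V → ℝ := fun u => z u + if u = p then δ else 0 with hy
  have hyp : y p = z p + δ := by simp [hy]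
  have hyn : ∀ u, u ≠ p → y u = z u := fun u hu => by simp [hy, hu]
  have hsum : ∀ v, ∑ u ∈ G.neighborFinset v, y u = rho G * z v + if v = b then δ else 0 := by
    intro v
    simp only [hy, Finset.sum_add_distrib, he, Finset.sum_ite_eq', SimpleGraph.mem_neighborFinset,
      G.adj_comm v p, hp]
  have hypos : ∀ v, 0 < y v := by
    intro v
    have := hz v
    simp only [hy]
    split_ifs <;> linarith
  have key : ∀ v, v ≠ b → ∑ u ∈ (rotate G b p c).neighborFinset v, y u ≤ rho G * y v := by
    intro v hvb
    rw [sum_neighborFinset_rotate hbc hpc' hpc hpb, hsum, if_neg hvb, if_neg hvb]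
    by_cases hvc : v = c
    · subst hvc
      rw [if_pos rfl, if_neg hpc.symm, hyp, hyn _ hpc.symm, hyn _ hpb.symm]
      have : 2 * (z p + δ) ≤ rho G * (z p + δ) :=
        mul_le_mul_of_nonneg_right hρ (by have := hz p; linarith)
      nlinarith
    rw [if_neg hvc]
    by_cases hvp : v = p
    · subst hvp
      rw [if_pos rfl, hyp, hyn _ hpc.symm]
      linarith
    · rw [if_neg hvp, hyn _ hvp]
      linarith
  have hb : ∑ u ∈ (rotate G b p c).neighborFinset b, y u < rho G * y b := by
    rw [sum_neighborFinset_rotate hbc hpc' hpc hpb, hsum, if_pos rfl, if_pos rfl, if_neg hbc.ne,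
      if_neg hpb.symm, hyn _ hpc.symm, hyn _ hpb.symm]
    nlinarith
  refine rho_lt_of_forall_le (rotate_connected hG hp hbc.ne hpc hbc (Or.inl rfl)) hypos
    (fun v => ?_) ⟨b, hb⟩
  by_cases hvb : v = b
  · rw [hvb]; exact hb.le
  · exact key v hvb

/-- If `x` has at least three neighbours, two of which are `b` and `c`, then rotating the edge `xc`
to a pendant vertex of `b` decreases the spectral radius. -/
theorem rho_rotate_lt_of_three_le_degree (hG : G.Connected) (hp : ∀ w, G.Adj p w ↔ w = b)
    (hbc : b ≠ c) (hpc : p ≠ c) (hxc : G.Adj x c) (hxb : G.Adj x b) (hx : 3 ≤ G.degree x) :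
    rho (rotate G x p c) < rho G := by
  have := hG.nonempty
  obtain ⟨z, hz, he⟩ := exists_pos_eigenvector hG
  have hpb : p ≠ b := ((hp b).2 rfl).ne
  have hpx : p ≠ x := fun h => hbc ((hp c).1 (h ▸ hxc)).symm
  have hpc' : ¬ G.Adj p c := fun h => hbc ((hp c).1 h).symm
  have hpz : rho G * z p = z b := by
    rw [← he, show G.neighborFinset p = {b} by ext; simp [hp], Finset.sum_singleton]
  have hρ0 : 0 < rho G := pos_of_mul_pos_left (by rw [hpz]; exact hz b) (hz p).le
  have hx3 : z b + z c < rho G * z x := by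
    have hsub : ({b, c} : Finset V) ⊆ G.neighborFinset x := by
      intro u hu
      simp only [Finset.mem_insert, Finset.mem_singleton] at hu
      rw [SimpleGraph.mem_neighborFinset]
      rcases hu with rfl | rfl <;> assumption
    have hlt : #({b, c} : Finset V) < #(G.neighborFinset x) := by
      rw [Finset.card_pair hbc, SimpleGraph.card_neighborFinset_eq_degree]; omega
    obtain ⟨d, hd, hd'⟩ := Finset.exists_mem_notMem_of_card_lt_card hlt
    rw [← he, ← Finset.sum_pair hbc]
    exact Finset.sum_lt_sum_of_subset hsub hd hd' (hz d) fun u _ _ => (hz u).le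
  -- Moving weight `δ` from `x` to `p` keeps the equations at `x` and `p` exact, and cancels at `b`.
  -- The strict gain is at `c`, where the third neighbour of `x` gives `z p + δ < z x`.
  set δ := z c / rho G with hδ
  have hδ0 : 0 < δ := div_pos (hz c) hρ0
  have hδρ : rho G * δ = z c := mul_div_cancel₀ _ hρ0.ne'
  set y : V → ℝ := fun u => z u + ((if u = p then δ else 0) + if u = x then -δ else 0) with hy
  have hyp : y p = z p + δ := by simp [hy, hpx]
  have hyx : y x = z x - δ := by simp [hy, hpx.symm, sub_eq_add_neg]
  have hyn : ∀ u, u ≠ p → u ≠ x → y u = z u := fun u hu hu' => by simp [hy, hu, hu']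
  have hsum : ∀ v, ∑ u ∈ G.neighborFinset v, y u =
      rho G * z v + ((if v = b then δ else 0) + if G.Adj v x then -δ else 0) := by
    intro v
    simp only [hy, Finset.sum_add_distrib, he, Finset.sum_ite_eq', SimpleGraph.mem_neighborFinset,
      G.adj_comm v p, hp]
  have hypos : ∀ v, 0 < y v := by
    intro v
    by_cases hvp : v = p
    · rw [hvp, hyp]; have := hz p; linarith
    by_cases hvx : v = x
    · rw [hvx, hyx]
      have : rho G * δ < rho G * z x := by have := hz b; linarith
      have := lt_of_mul_lt_mul_left this hρ0.le
      linarith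
    · rw [hyn v hvp hvx]; exact hz v
  have hc : ∑ u ∈ (rotate G x p c).neighborFinset c, y u < rho G * y c := by
    rw [sum_neighborFinset_rotate hxc hpc' hpc hpx, hsum, if_neg hbc.symm, if_pos hxc.symm,
      if_neg hxc.ne.symm, if_pos rfl, if_neg hpc.symm, hyp, hyx, hyn _ hpc.symm hxc.ne.symm]
    have : z p + δ < z x := by
      refine lt_of_mul_lt_mul_left (a := rho G) ?_ hρ0.le
      rw [mul_add, hpz, hδρ]; exact hx3
    linarith
  refine rho_lt_of_forall_le (rotate_connected hG hp hbc hpc hxc (Or.inr hxb)) hypos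
    (fun v => ?_) ⟨c, hc⟩
  by_cases hvc : v = c
  · rw [hvc]; exact hc.le
  rw [sum_neighborFinset_rotate hxc hpc' hpc hpx, hsum, if_neg hvc]
  by_cases hvx : v = x
  · subst hvx
    rw [if_pos rfl, if_neg hpx.symm, if_neg hxb.ne, if_neg (G.irrefl), hyx,
      hyn _ hpc.symm hxc.ne.symm]
    linarith
  rw [if_neg hvx]
  by_cases hvp : v = p
  · subst hvp
    have : ¬ G.Adj v x := fun h => hxb.ne ((hp x).1 h)
    rw [if_pos rfl, if_neg hpb, if_neg this, hyp, hyn _ hpc.symm hxc.ne.symm]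
    linarith
  rw [if_neg hvp, hyn v hvp hvx]
  by_cases hvb : v = b
  · subst hvb
    rw [if_pos rfl, if_pos hxb.symm]
    linarith
  · rw [if_neg hvb]
    split_ifs <;> linarith

/-- If every vertex of `C` has a pendant neighbour, rotating an edge `xc` to a pendant neighbour of
a vertex `b ∈ C` preserves the independence number. -/
theorem indepNum_rotate {C : Finset V} (hI : ∀ u ∉ C, ∀ v ∉ C, ¬ G.Adj u v) {q : V → V}
    (hqC : ∀ v ∈ C, q v ∉ C) (hq : ∀ v ∈ C, ∀ w, G.Adj (q v) w ↔ w = v) (hb : b ∈ C) (hc : c ∈ C)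
    (hbc : b ≠ c) (hx : x = b ∨ G.Adj x b) :
    (rotate G x (q b) c).indepNum = Fintype.card V - #C := by
  refine indepNum_eq_of_injOn (fun u hu v hv h => ?_) q (fun u hu v hv h => ?_) hqC
    (fun v hv => ?_)
  · rcases h.2 with h | h | h
    · exact hI u hu v hv h.1
    · exact hv (h.2 ▸ hc)
    · exact hu (h.1 ▸ hc)
  · have := (hq u hu u).2 rfl
    rw [h] at this
    exact (hq v hv u).1 this
  · have hadj : G.Adj v (q v) := ((hq v hv v).2 rfl).symm
    refine ⟨hadj.ne, Or.inl ⟨hadj, fun h => hqC v hv (h.2 ▸ hc), fun h => ?_⟩⟩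
    rcases hx with rfl | hx
    · exact hqC v hv (h.2 ▸ hb)
    · have := (hq v hv b).1 (h.2 ▸ hx)
      exact hbc (this.trans h.1)

end Rotation

/-! ### Edge counting and the tree structure of minimizers. -/

section Structure

/-- `T` is a tree obtained from a tree on `C` by subdividing every edge once and attaching pendant
vertices to vertices of `C`. -/
structure IsSubdividedTree {V : Type*} [Fintype V] (T : SimpleGraph V) (C : Finset V) : Prop where
  isTree : T.IsTree
  mem_iff_of_adj : ∀ u v, T.Adj u v → (u ∈ C ↔ v ∉ C)
  degree_le_two : ∀ i ∉ C, T.degree i ≤ 2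

variable {V : Type*} [Fintype V] {G : SimpleGraph V} {C : Finset V}

/-- The pendant neighbours of `v` outside `C`. -/
noncomputable def pendants (G : SimpleGraph V) (C : Finset V) (v : V) : Finset V :=
  {i | i ∉ C ∧ ∀ w, G.Adj i w ↔ w = v}

/-- A connected graph has at least `|V| - 1` edges, and here each of them meets `C`. -/
theorem card_le_sum_degree (hG : G.Connected) (hI : ∀ u ∉ C, ∀ v ∉ C, ¬ G.Adj u v) :
    Fintype.card V ≤ ∑ v ∈ C, G.degree v + 1 := by
  have h1 := hG.card_vert_le_card_edgeSet_add_one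
  rw [Nat.card_eq_fintype_card, Nat.card_eq_fintype_card, ← SimpleGraph.edgeFinset_card] at h1
  have h2 : G.edgeFinset ⊆ C.biUnion fun v => G.incidenceFinset v := by
    intro e
    induction e with
    | h u v =>
      intro he
      rw [SimpleGraph.mem_edgeFinset, SimpleGraph.mem_edgeSet] at he
      simp only [Finset.mem_biUnion, SimpleGraph.mem_incidenceFinset]
      by_cases hu : u ∈ C
      · exact ⟨u, hu, (SimpleGraph.mk'_mem_incidenceSet_left_iff _).2 he⟩
      · by_cases hv : v ∈ C
        · exact ⟨v, hv, (SimpleGraph.mk'_mem_incidenceSet_right_iff _).2 he⟩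
        · exact absurd he (hI u hu v hv)
  have h3 := (Finset.card_le_card h2).trans Finset.card_biUnion_le
  simp only [SimpleGraph.card_incidenceFinset_eq_degree] at h3
  omega

/-- Double counting of the edges between `C` and `Cᶜ`: a vertex of `Cᶜ` adjacent to `v` has a second
neighbour unless it is a pendant of `v`, so the contribution of `v` itself cancels. -/
theorem card_compl_add_le (hG : G.Connected) (hI : ∀ u ∉ C, ∀ v ∉ C, ¬ G.Adj u v) {v : V}
    (hv : v ∈ C) :
    #Cᶜ + #{i ∈ Cᶜ | 3 ≤ G.degree i} ≤
      #(pendants G C v) + ∑ u ∈ C.erase v, #{i ∈ Cᶜ | G.Adj u i} := by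
  have hpt : ∀ i ∈ Cᶜ, 1 + (if 3 ≤ G.degree i then 1 else 0) + (if G.Adj v i then 1 else 0) ≤
      #{u ∈ C | G.Adj u i} + if i ∈ pendants G C v then 1 else 0 := by
    intro i hi
    rw [Finset.mem_compl] at hi
    have hN : G.neighborFinset i = ({u ∈ C | G.Adj u i} : Finset V) := by
      ext u
      simp only [SimpleGraph.mem_neighborFinset, Finset.mem_filter, G.adj_comm u i]
      exact ⟨fun h => ⟨by_contra fun hu => hI i hi u hu h, h⟩, fun h => h.2⟩
    rw [← hN, SimpleGraph.card_neighborFinset_eq_degree]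
    have h1 : 1 ≤ G.degree i := by
      have : Nontrivial V := ⟨⟨v, i, fun h => hi (h ▸ hv)⟩⟩
      exact hG.preconnected.degree_pos_of_nontrivial i
    by_cases ha : G.Adj v i
    · rw [if_pos ha]
      by_cases hp : i ∈ pendants G C v
      · rw [if_pos hp]
        split_ifs <;> omega
      · have h2 : G.degree i ≠ 1 := by
          intro h
          obtain ⟨w, hw⟩ := Finset.card_eq_one.1 h
          have hw' : ∀ u, G.Adj i u ↔ u = w := fun u => by
            rw [← SimpleGraph.mem_neighborFinset, hw, Finset.mem_singleton]
          refine hp ?_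
          rw [pendants, Finset.mem_filter]
          refine ⟨Finset.mem_univ _, hi, ?_⟩
          rw [(hw' v).1 ha.symm]
          exact hw'
        split_ifs <;> omega
    · rw [if_neg ha]
      split_ifs <;> omega
  have h := Finset.sum_le_sum hpt
  simp only [Finset.sum_add_distrib, ← Finset.card_filter, Finset.sum_const, smul_eq_mul,
    mul_one] at h
  have hdc : ∑ i ∈ Cᶜ, #{u ∈ C | G.Adj u i} = ∑ u ∈ C, #{i ∈ Cᶜ | G.Adj u i} :=
    (Finset.sum_card_bipartiteAbove_eq_sum_card_bipartiteBelow (s := C) (t := Cᶜ) G.Adj).symm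
  rw [hdc, ← Finset.add_sum_erase C _ hv] at h
  have hp : #{i ∈ Cᶜ | i ∈ pendants G C v} ≤ #(pendants G C v) :=
    Finset.card_le_card fun i hi => (Finset.mem_filter.1 hi).2
  omega

/-- A lower bound for the number of pendant neighbours of a vertex of `C`, which improves by one if
`G` is not obtained from a multigraph on `C` by subdividing edges and attaching pendant vertices. -/
theorem card_compl_le_of_degree_le (hG : G.Connected) (hI : ∀ u ∉ C, ∀ v ∉ C, ¬ G.Adj u v) {s : ℕ}
    (hs : ∀ u ∈ C, G.degree u ≤ s) {v : V} (hv : v ∈ C) :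
    #Cᶜ ≤ #(pendants G C v) + (#C - 1) * s ∧
      ((∃ i ∉ C, 3 ≤ G.degree i) ∨ (∃ a ∈ C, ∃ b ∈ C, G.Adj a b) →
        #Cᶜ < #(pendants G C v) + (#C - 1) * s) := by
  have h := card_compl_add_le hG hI hv
  have hle : ∀ u ∈ C.erase v, #{i ∈ Cᶜ | G.Adj u i} ≤ s := by
    intro u hu
    refine le_trans (Finset.card_le_card ?_) (hs u (Finset.mem_of_mem_erase hu))
    intro i hi
    rw [SimpleGraph.mem_neighborFinset]
    exact (Finset.mem_filter.1 hi).2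
  have hsum := Finset.sum_le_sum hle
  rw [Finset.sum_const, smul_eq_mul, Finset.card_erase_of_mem hv] at hsum
  refine ⟨by omega, ?_⟩
  rintro (⟨i, hi, hd⟩ | ⟨a, ha, b, hb, hab⟩)
  · have : 0 < #{i ∈ Cᶜ | 3 ≤ G.degree i} :=
      Finset.card_pos.2 ⟨i, Finset.mem_filter.2 ⟨Finset.mem_compl.2 hi, hd⟩⟩
    omega
  · have key : ∀ a ∈ C, ∀ b ∈ C, G.Adj a b → a ≠ v →
        ∑ u ∈ C.erase v, #{i ∈ Cᶜ | G.Adj u i} < ∑ u ∈ C.erase v, s := by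
      intro a ha b hb hab hav
      refine Finset.sum_lt_sum hle ⟨a, Finset.mem_erase.2 ⟨hav, ha⟩, ?_⟩
      refine lt_of_lt_of_le (Finset.card_lt_card ?_) (hs a ha)
      refine Finset.ssubset_iff_of_subset ?_ |>.2 ⟨b, ?_, ?_⟩
      · intro i hi
        rw [SimpleGraph.mem_neighborFinset]
        exact (Finset.mem_filter.1 hi).2
      · rwa [SimpleGraph.mem_neighborFinset]
      · simp [hb]
    -- An edge inside `C` has an end other than `v`, and that end spends part of its degree inside
    -- `C`.
    have hlt : ∑ u ∈ C.erase v, #{i ∈ Cᶜ | G.Adj u i} < ∑ u ∈ C.erase v, s := by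
      by_cases hav : a = v
      · exact key b hb a ha hab.symm fun h => hab.ne (hav.trans h.symm)
      · exact key a ha b hb hab hav
    rw [Finset.sum_const, smul_eq_mul, Finset.card_erase_of_mem hv] at hlt
    omega

/-- Without a leaf outside `C` the tree would have at least `2 (|V| - #C) ≥ |V|` edges. Hence there
is a pendant vertex to start the matching from. -/
theorem IsSubdividedTree.indepNum_eq (hG : IsSubdividedTree G C) (h1 : 1 ≤ #C)
    (hC : 2 * #C ≤ Fintype.card V) : G.indepNum = Fintype.card V - #C := by
  refine indepNum_eq_of_degree_le_two hG.isTree.connected hG.mem_iff_of_adj hG.degree_le_two ?_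
  by_contra! hno
  have h2 : ∀ i ∈ Cᶜ, 2 ≤ G.degree i := by
    intro i hi
    rw [Finset.mem_compl] at hi
    have : Nontrivial V := Fintype.one_lt_card_iff_nontrivial.1 (by omega)
    have h1 := hG.isTree.connected.preconnected.degree_pos_of_nontrivial i
    have := hno i hi
    omega
  have hB : G.IsBipartiteWith (↑(Cᶜ) : Set V) (↑C : Set V) :=
    ⟨by rw [Finset.disjoint_coe]; exact disjoint_compl_left, fun u v h => by
      have := hG.mem_iff_of_adj u v h
      simp only [Finset.coe_compl, Set.mem_compl_iff, Finset.mem_coe]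
      tauto⟩
  have h3 := SimpleGraph.isBipartiteWith_sum_degrees_eq_card_edges hB
  have h4 := Finset.card_nsmul_le_sum _ _ 2 h2
  have h5 := hG.isTree.card_edgeFinset
  rw [smul_eq_mul, Finset.card_compl] at h4
  omega

variable {n k s l : ℕ}

theorem IsMinimizer.degree_le {T : SimpleGraph V} (hT : IsMinimizer n (n - k) T)
    (hs : ∃ G : SimpleGraph (Fin n), InClass n (n - k) G ∧ rho G < √(s + 1)) (v : V) :
    T.degree v ≤ s := by
  obtain ⟨G, hG, hlt⟩ := hs
  have hne := hT.1.1.nonempty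
  have h1 := (hT.2 G hG).trans_lt hlt
  have h2 : rho T ^ 2 < s + 1 := (Real.lt_sqrt (rho_nonneg T)).1 h1
  have h3 : (T.degree v : ℝ) < s + 1 := (degree_le_rho_sq hT.1.1 v).trans_lt h2
  exact Nat.lt_succ_iff.1 (by exact_mod_cast h3)

/-- A defect in the structure supplies slack in the counting, the slack supplies pendant vertices `q
v`, and these allow a rotation contradicting minimality. -/
theorem IsMinimizer.isSubdividedTree {T : SimpleGraph V} (hT : IsMinimizer n (n - k) T)
    (hs : ∃ G : SimpleGraph (Fin n), InClass n (n - k) G ∧ rho G < √(s + 1))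
    (hk : 1 ≤ k) (hn : 2 * k ≤ n) (hks : (k - 1) * s + k ≤ n) (hk2 : 2 ≤ k → 3 * k + 2 ≤ n)
    (hC : #C = k) (hI : ∀ u ∉ C, ∀ v ∉ C, ¬ T.Adj u v) : IsSubdividedTree T C := by
  have hconn := hT.1.1
  have hne := hconn.nonempty
  have hcard := hT.1.2.1
  have hds := hT.degree_le hs
  have hCc : #Cᶜ = n - k := by rw [Finset.card_compl, hcard, hC]
  have hslack : ((∃ i ∉ C, 3 ≤ T.degree i) ∨ (∃ a ∈ C, ∃ b ∈ C, T.Adj a b)) →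
      ∃ q : V → V, (∀ v ∈ C, q v ∉ C) ∧ ∀ v ∈ C, ∀ w, T.Adj (q v) w ↔ w = v := by
    intro h
    have : ∀ v ∈ C, ∃ i, i ∉ C ∧ ∀ w, T.Adj i w ↔ w = v := by
      intro v hv
      have := (card_compl_le_of_degree_le hconn hI (fun u _ => hds u) hv).2 h
      rw [hC, hCc] at this
      obtain ⟨i, hi⟩ := Finset.card_pos.1 (show 0 < #(pendants T C v) by omega)
      exact ⟨i, (Finset.mem_filter.1 hi).2⟩
    choose! q hq using this
    exact ⟨q, fun v hv => (hq v hv).1, fun v hv => (hq v hv).2⟩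
  have hclass : ∀ {H : SimpleGraph V}, H.Connected → H.indepNum = Fintype.card V - #C →
      rho T ≤ rho H := fun h1 h2 => hT.le_rho ⟨h1, hcard, by rw [h2, hcard, hC]⟩
  have hCC : ∀ a ∈ C, ∀ b ∈ C, T.Adj a b → False := by
    intro a ha b hb hab
    obtain ⟨q, hqC, hq⟩ := hslack (Or.inr ⟨a, ha, b, hb, hab⟩)
    obtain ⟨z, hz, he⟩ := exists_pos_eigenvector hconn
    have h2k : 2 ≤ k := by
      rw [← hC]; exact Finset.one_lt_card.2 ⟨a, ha, b, hb, hab.ne⟩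
    -- Otherwise all degrees are at most 3, so `n ≤ 3 * k + 1`.
    have hρ : 2 ≤ rho T := by
      by_contra! hlt
      have hd3 : ∀ v ∈ C, T.degree v ≤ 3 := by
        intro v _
        have h1 := degree_le_rho_sq hconn v
        have h2 : rho T ^ 2 < 4 := by have := rho_nonneg T; nlinarith
        have h3 : (T.degree v : ℝ) < 4 := h1.trans_lt h2
        have : T.degree v < 4 := by exact_mod_cast h3
        omega
      have h4 := card_le_sum_degree hconn hI
      have h5 := Finset.sum_le_card_nsmul C _ 3 hd3
      rw [hC, smul_eq_mul] at h5
      have := hk2 h2k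
      omega
    have key : ∀ a ∈ C, ∀ b ∈ C, T.Adj a b → z b ≤ z a → False := by
      intro a ha b hb hab hle
      have hqb : q a ≠ b := fun h => hqC a ha (h ▸ hb)
      have h1 := rho_rotate_lt_of_adj hconn (hq a ha) hqb hab hρ hz he hle
      exact h1.not_ge (hclass (rotate_connected hconn (hq a ha) hab.ne hqb hab (Or.inl rfl))
        (indepNum_rotate hI hqC hq ha hb hab.ne (Or.inl rfl)))
    rcases le_total (z b) (z a) with h | h
    · exact key a ha b hb hab h
    · exact key b hb a ha hab.symm h
  have hbip : ∀ u v, T.Adj u v → (u ∈ C ↔ v ∉ C) := fun u v huv =>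
    ⟨fun hu hv => hCC u hu v hv huv, fun hv => by_contra fun hu => hI u hu v hv huv⟩
  have hdeg : ∀ i ∉ C, T.degree i ≤ 2 := by
    intro i hi
    by_contra! h3
    obtain ⟨q, hqC, hq⟩ := hslack (Or.inl ⟨i, hi, h3⟩)
    obtain ⟨b, hb, c, hc, hbc⟩ := Finset.one_lt_card.1 (show 1 < #(T.neighborFinset i) by
      rw [SimpleGraph.card_neighborFinset_eq_degree]; omega)
    rw [SimpleGraph.mem_neighborFinset] at hb hc
    have hbC : b ∈ C := by have := hbip i b hb; tauto
    have hcC : c ∈ C := by have := hbip i c hc; tauto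
    have hqb : q b ≠ c := fun h => hqC b hbC (h ▸ hcC)
    have h1 := rho_rotate_lt_of_three_le_degree hconn (hq b hbC) hbc hqb hc hb h3
    exact h1.not_ge (hclass (rotate_connected hconn (hq b hbC) hbc hqb hc (Or.inr hb))
      (indepNum_rotate hI hqC hq hbC hcC hbc (Or.inr hb)))
  refine ⟨?_, hbip, hdeg⟩
  -- A proper spanning tree would stay in the class and have smaller spectral radius.
  obtain ⟨S, hST, hS⟩ := hconn.exists_isTree_le
  rcases hST.eq_or_lt with rfl | hlt
  · exact hS
  exfalso
  have hlt' := rho_lt_of_lt hconn hS.connected hlt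
  have hSC : IsSubdividedTree S C := ⟨hS, fun u v h => hbip u v (hST h), fun i hi =>
    (SimpleGraph.degree_le_of_le hST).trans (hdeg i hi)⟩
  exact hlt'.not_ge (hclass hS.connected (hSC.indepNum_eq (by omega) (by omega)))

theorem IsMinimizer.le_card_pendants {T : SimpleGraph V} (hT : IsMinimizer n (n - k) T)
    (hs : ∃ G : SimpleGraph (Fin n), InClass n (n - k) G ∧ rho G < √(s + 1))
    (hks : (k - 1) * s + k + l ≤ n) (hC : #C = k) (hI : ∀ u ∉ C, ∀ v ∉ C, ¬ T.Adj u v)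
    {v : V} (hv : v ∈ C) : l ≤ #(pendants T C v) := by
  have h := (card_compl_le_of_degree_le hT.1.1 hI (fun u _ => hT.degree_le hs u) hv).1
  rw [Finset.card_compl, hT.1.2.1, hC] at h
  omega

theorem IsMinimizer.three_le_degree {T : SimpleGraph V} (hT : IsMinimizer n (n - k) T)
    (hs : ∃ G : SimpleGraph (Fin n), InClass n (n - k) G ∧ rho G < √(s + 1))
    (hks : (k - 1) * s + 4 ≤ n) (hC : #C = k) (hI : ∀ u ∉ C, ∀ v ∉ C, ¬ T.Adj u v)
    {v : V} (hv : v ∈ C) : 3 ≤ T.degree v := by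
  have h := card_le_sum_degree hT.1.1 hI
  have h2 := Finset.sum_le_card_nsmul (C.erase v) _ s fun u _ => hT.degree_le hs u
  rw [Finset.card_erase_of_mem hv, smul_eq_mul, hC] at h2
  rw [hT.1.2.1, ← Finset.add_sum_erase C _ hv] at h
  omega

end Structure

/-! ### Identification of the even vertices with `C`. -/

section EvenVertices

variable {V : Type*} [Fintype V] {T : SimpleGraph V} {C : Finset V}

theorem ncard_neighborSet (T : SimpleGraph V) (v : V) : (T.neighborSet v).ncard = T.degree v := by
  rw [← SimpleGraph.card_neighborFinset_eq_degree, ← Set.ncard_coe_finset]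
  simp

theorem nonempty_iso_pathGraph_one {W : Type*} {H : SimpleGraph W} {y : W}
    (hy : ∀ z, H.Reachable y z → z = y) :
    Nonempty ((H.connectedComponentMk y).toSimpleGraph ≃g SimpleGraph.pathGraph 1) := by
  let u : Unique (H.connectedComponentMk y) :=
    ⟨⟨⟨y, SimpleGraph.ConnectedComponent.connectedComponentMk_mem⟩⟩, fun z =>
      Subtype.ext (hy z (SimpleGraph.ConnectedComponent.exact z.2).symm)⟩
  refine ⟨⟨Equiv.ofUnique _ _, ?_⟩⟩
  intro a b
  rw [Subsingleton.elim a b]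
  simp

/-- Each pendant neighbour of `v` is a one-vertex path component of `T - v`. -/
theorem isControlVertex_of_card_sdiff_le_one {v : V} (hv : v ∈ C) (h3 : 3 ≤ T.degree v)
    (h1 : #(T.neighborFinset v \ pendants T C v) ≤ 1) : IsControlVertex T v := by
  refine Or.inr ⟨by rwa [ncard_neighborSet], ?_⟩
  have hdeg : T.degree v ≤ #(pendants T C v) + 1 := by
    rw [← SimpleGraph.card_neighborFinset_eq_degree]
    have := Finset.card_le_card_sdiff_add_card (s := T.neighborFinset v) (t := pendants T C v)
    omega
  rw [ncard_neighborSet]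
  refine hdeg.trans (Nat.add_le_add_right ?_ 1)
  set H := T.induce ({v}ᶜ : Set V) with hH
  have hiso : ∀ y : ({v}ᶜ : Set V), (y : V) ∈ pendants T C v → ∀ z, H.Reachable y z → z = y := by
    rintro y hy z ⟨w⟩
    cases w with
    | nil => rfl
    | @cons _ b _ h _ =>
      have hadj : T.Adj y b := h
      exact absurd (((Finset.mem_filter.1 hy).2.2 b).1 hadj) b.2
  set S : Set ({v}ᶜ : Set V) := Subtype.val ⁻¹' (↑(pendants T C v) : Set V) with hS
  have hcardS : S.ncard = #(pendants T C v) := by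
    rw [hS, Set.ncard_preimage_of_injective_subset_range Subtype.val_injective, Set.ncard_coe_finset]
    intro i hi
    rw [Subtype.range_coe]
    rintro rfl
    exact (Finset.mem_filter.1 hi).2.1 hv
  have hinj : Set.InjOn H.connectedComponentMk S := by
    intro y hy z _ hyz
    exact (hiso y hy z (SimpleGraph.ConnectedComponent.exact hyz)).symm
  rw [← hcardS, ← hinj.ncard_image]
  refine Set.ncard_le_ncard ?_ (Set.toFinite _)
  rintro _ ⟨y, hy, rfl⟩
  exact ⟨1, nonempty_iso_pathGraph_one (hiso y hy)⟩

theorem even_iff_getVert_mem (hT : IsSubdividedTree T C) {a b : V} (ha : a ∈ C) (p : T.Walk a b)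
    {i : ℕ} (hi : i ≤ p.length) : Even i ↔ p.getVert i ∈ C := by
  induction i with
  | zero => simpa using ha
  | succ i ih =>
    have h1 := hT.mem_iff_of_adj _ _ (p.adj_getVert_succ hi)
    rw [Nat.even_add_one, ih (by omega)]
    tauto

/-- A path between vertices of `C` that cannot be prolonged ends in a control vertex. -/
theorem isControlVertex_of_maximal (hT : IsSubdividedTree T C) {a b : V} (hb : b ∈ C)
    (h3 : 3 ≤ T.degree b) (p : T.Walk a b) (hp : p.IsPath)
    (hmax : ∀ c ∈ C, ∀ q : T.Walk a c, q.IsPath → p.support ⊆ q.support → q.length ≤ p.length) :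
    IsControlVertex T b := by
  by_contra hcon
  have h2 : 1 < #(T.neighborFinset b \ pendants T C b) := by
    by_contra! h
    exact hcon (isControlVertex_of_card_sdiff_le_one hb h3 h)
  -- A second non-pendant neighbour `i` lies off the path by acyclicity, and so does its other
  -- neighbour `w ∈ C`; the path extends by two steps.
  obtain ⟨i, hi, hne⟩ := Finset.exists_mem_ne h2 p.penultimate
  rw [Finset.mem_sdiff, SimpleGraph.mem_neighborFinset] at hi
  obtain ⟨hbi, hip⟩ := hi
  have hiC : i ∉ C := (hT.mem_iff_of_adj b i hbi).1 hb
  have hisupp : i ∉ p.support := fun h =>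
    hne (hT.isTree.isAcyclic.eq_penultimate_of_adj_end hp hbi h)
  have hpi := hp.concat hisupp hbi
  obtain ⟨w, hiw, hwb⟩ : ∃ w, T.Adj i w ∧ w ≠ b := by
    by_contra! h
    refine hip (Finset.mem_filter.2 ⟨Finset.mem_univ _, hiC, fun w => ⟨h w, ?_⟩⟩)
    rintro rfl
    exact hbi.symm
  have hwsupp : w ∉ (p.concat hbi).support := fun h => hwb <| by
    rw [hT.isTree.isAcyclic.eq_penultimate_of_adj_end hpi hiw h,
      SimpleGraph.Walk.penultimate_concat]
  have hwC : w ∈ C := by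
    have := hT.mem_iff_of_adj i w hiw
    tauto
  have := hmax w hwC _ (hpi.concat hwsupp hiw) fun x hx => by
    simp only [SimpleGraph.Walk.support_concat, List.mem_append, hx, true_or]
  rw [SimpleGraph.Walk.length_concat, SimpleGraph.Walk.length_concat] at this
  omega

theorem evenVertices_eq (hT : IsSubdividedTree T C) (hC : 2 ≤ #C) (h3 : ∀ v ∈ C, 3 ≤ T.degree v) :
    evenVertices T = C := by
  have hcon : ∀ v, IsControlVertex T v → v ∈ C := by
    rintro v (h | h)
    · obtain ⟨x, _, y, _, hxy⟩ := Finset.one_lt_card.1 hC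
      exact absurd ((h x).trans (h y).symm) hxy
    · by_contra hv
      have := hT.degree_le_two v hv
      rw [ncard_neighborSet] at h
      omega
  ext x
  constructor
  · rintro ⟨a, b, ha, _, p, _, i, hi, hei, rfl⟩
    exact (even_iff_getVert_mem hT (hcon a ha) p hi).1 hei
  · intro hx
    set L : Set ℕ := {m | ∃ a ∈ C, ∃ b ∈ C, ∃ p : T.Walk a b, p.IsPath ∧ x ∈ p.support ∧
      p.length = m} with hL
    have hne : L.Nonempty :=
      ⟨0, x, hx, x, hx, SimpleGraph.Walk.nil, SimpleGraph.Walk.IsPath.nil, by simp, rfl⟩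
    have hbdd : BddAbove L := by
      refine ⟨Fintype.card V, ?_⟩
      rintro _ ⟨a, _, b, _, p, hp, _, rfl⟩
      exact hp.length_lt.le
    obtain ⟨a, ha, b, hb, p, hp, hxp, hlen⟩ := Nat.sSup_mem hne hbdd
    have hmax : ∀ a ∈ C, ∀ b ∈ C, ∀ q : T.Walk a b, q.IsPath → x ∈ q.support →
        q.length ≤ p.length := by
      intro a ha b hb q hq hxq
      rw [hlen]
      exact le_csSup hbdd ⟨a, ha, b, hb, q, hq, hxq, rfl⟩
    have hcb := isControlVertex_of_maximal hT hb (h3 b hb) p hp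
      fun c hc q hq hsub => hmax a ha c hc q hq (hsub hxp)
    have hca := isControlVertex_of_maximal hT ha (h3 a ha) p.reverse hp.reverse
      fun c hc q hq hsub => by
        rw [SimpleGraph.Walk.length_reverse]
        exact hmax b hb c hc q hq (hsub (by simpa using hxp))
    obtain ⟨i, hi, hle⟩ := SimpleGraph.Walk.mem_support_iff_exists_getVert.1 hxp
    exact ⟨a, b, hca, hcb, p, hp, i, hle,
      (even_iff_getVert_mem hT ha p hle).2 (by rw [hi]; exact hx), hi⟩

end EvenVertices

/-! ### Spectral radius and class membership after attaching pendant vertices, and the inverse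
operation. -/

section Attach

variable {V : Type*} {K : SimpleGraph V} {A : Set V} {l : ℕ}

theorem attach_connected_iff : (attach K A l).Connected ↔ K.Connected := by
  let φ : V ⊕ (A × Fin l) → V := Sum.elim id fun p => p.1
  constructor
  · intro h
    have hadj : ∀ x y, (attach K A l).Adj x y → K.Reachable (φ x) (φ y) := by
      rintro (u | p) (v | q) h
      · exact SimpleGraph.Adj.reachable h
      · have h' : u = q.1 := h
        exact h' ▸ SimpleGraph.Reachable.refl _
      · have h' : v = p.1 := h
        exact h' ▸ SimpleGraph.Reachable.refl _
      · exact h.elim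
    have hwalk : ∀ x y, (attach K A l).Walk x y → K.Reachable (φ x) (φ y) := by
      intro x y w
      induction w with
      | nil => exact SimpleGraph.Reachable.refl _
      | cons h _ ih => exact (hadj _ _ h).trans ih
    exact { preconnected := fun u v => (h.preconnected (Sum.inl u) (Sum.inl v)).elim (hwalk _ _)
            nonempty := h.nonempty.map φ }
  · intro h
    have hl : ∀ u v, (attach K A l).Reachable (Sum.inl u) (Sum.inl v) := fun u v =>
      (h.preconnected u v).map (⟨Sum.inl, fun h => h⟩ : K →g attach K A l)
    have hr : ∀ x, (attach K A l).Reachable x (Sum.inl (φ x)) := by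
      rintro (u | p)
      · exact SimpleGraph.Reachable.refl _
      · refine SimpleGraph.Adj.reachable ?_
        exact rfl
    exact { preconnected := fun x y => ((hr x).trans (hl _ _)).trans (hr y).symm
            nonempty := h.nonempty.map Sum.inl }

/-- Attaching no pendant vertices does not change the graph. -/
def attachZeroIso (K : SimpleGraph V) (A : Set V) : attach K A 0 ≃g K where
  toEquiv := Equiv.sumEmpty V (A × Fin 0)
  map_rel_iff' := by
    rintro (u | p) (v | q)
    · exact Iff.rfl
    · exact q.2.elim0
    · exact p.2.elim0
    · exact p.2.elim0

variable [Fintype V]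

theorem rho_attach (hK : K.Connected) (hbip : ∀ u v, K.Adj u v → (u ∈ A ↔ v ∉ A))
    (hA : ∀ i ∉ A, ∃ w, K.Adj i w) : rho (attach K A l) = √(rho K ^ 2 + l) := by
  have hne := hK.nonempty
  rcases Nat.eq_zero_or_pos l with rfl | hl
  · rw [rho_congr (attachZeroIso K A), Nat.cast_zero, add_zero, Real.sqrt_sq (rho_nonneg K)]
  obtain ⟨x, hx, he⟩ := exists_pos_eigenvector hK
  have hl' : (0 : ℝ) < l := by exact_mod_cast hl
  set μ := √(rho K ^ 2 + l) with hμ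
  have hμ0 : 0 < μ := Real.sqrt_pos.2 (by positivity)
  have hμ2 : μ * μ = rho K ^ 2 + l := Real.mul_self_sqrt (by positivity)
  -- The Perron vector `x` of `K` is rescaled by `μ` on `A` and by `rho K` off `A`. At `v ∈ A` the
  -- neighbour sum becomes `(rho K ^ 2 + l) * x v = μ * (μ * x v)`.
  set y : V ⊕ (A × Fin l) → ℝ :=
    Sum.elim (fun v => if v ∈ A then μ * x v else rho K * x v) fun p => x p.1 with hy
  have hyl : ∀ v, y (Sum.inl v) = if v ∈ A then μ * x v else rho K * x v := fun v => rfl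
  refine rho_eq_of_pos_eigenvector (y := y) ?_ ?_
  · rintro (v | p)
    · rw [hyl]
      split_ifs with h
      · exact mul_pos hμ0 (hx v)
      · obtain ⟨w, hw⟩ := hA v h
        rw [← he]
        exact Finset.sum_pos (fun u _ => hx u) ⟨w, by simpa using hw⟩
    · exact hx _
  · rintro (v | p)
    · have h1 : ∀ u, (attach K A l).Adj (Sum.inl v) (Sum.inl u) ↔ K.Adj v u := fun _ => Iff.rfl
      have h2 : ∀ p, (attach K A l).Adj (Sum.inl v) (Sum.inr p) ↔ v = p.1 := fun _ => Iff.rfl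
      have h3 : ∑ p : A × Fin l, (if v = p.1 then y (Sum.inr p) else 0) =
          if v ∈ A then l * x v else 0 := by
        rw [Fintype.sum_prod_type]
        have : ∀ a : A, ∑ _j : Fin l, (if v = (a : V) then x a else 0) =
            if v = (a : V) then l * x a else 0 := by
          intro a; simp
        refine (Finset.sum_congr rfl fun a _ => this a).trans ?_
        by_cases hv : v ∈ A
        · rw [if_pos hv, Finset.sum_eq_single ⟨v, hv⟩]
          · simp
          · intro b _ hb
            exact if_neg fun h => hb (Subtype.ext (Eq.symm h))
          · simp
        · rw [if_neg hv]
          exact Finset.sum_eq_zero fun a _ => if_neg fun (h : v = a) => hv (h ▸ a.2)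
      rw [sum_neighborFinset_eq_sum_ite, Fintype.sum_sum_type]
      simp only [h1, h2]
      rw [h3, ← sum_neighborFinset_eq_sum_ite K (fun u => y (Sum.inl u)) v, hyl]
      by_cases hv : v ∈ A
      · rw [if_pos hv, if_pos hv]
        have : ∀ u ∈ K.neighborFinset v, y (Sum.inl u) = rho K * x u := by
          intro u hu
          rw [hyl, if_neg]
          exact (hbip v u (by simpa using hu)).1 hv
        rw [Finset.sum_congr rfl this, ← Finset.mul_sum, he, ← mul_assoc μ, hμ2]
        ring
      · rw [if_neg hv, if_neg hv]
        have : ∀ u ∈ K.neighborFinset v, y (Sum.inl u) = μ * x u := by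
          intro u hu
          rw [hyl, if_pos]
          have := hbip v u (by simpa using hu)
          tauto
        rw [Finset.sum_congr rfl this, ← Finset.mul_sum, he]
        ring
    · have : (attach K A l).neighborFinset (Sum.inr p) = {Sum.inl (p.1 : V)} := by
        ext z
        rw [SimpleGraph.mem_neighborFinset, Finset.mem_singleton]
        rcases z with u | q
        · rw [Sum.inl.injEq]; exact Iff.rfl
        · simp only [reduceCtorEq, iff_false]
          exact fun h => h
      rw [this, Finset.sum_singleton, hyl, if_pos p.1.2]
      rfl

theorem rho_eq_of_iso_attach (hK : K.Connected) (hbip : ∀ u v, K.Adj u v → (u ∈ A ↔ v ∉ A))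
    (hA : ∀ i ∉ A, ∃ w, K.Adj i w) {W : Type*} [Fintype W] {T : SimpleGraph W}
    (e : T ≃g attach K A l) : rho T = √(rho K ^ 2 + l) :=
  (rho_congr e).trans (rho_attach hK hbip hA)

theorem inClass_attach {C : Finset V} {n n₀ k : ℕ} (hK : K.Connected)
    (hI : ∀ u ∉ C, ∀ v ∉ C, ¬ K.Adj u v) (hcard : Fintype.card V = n₀) (hC : #C = k)
    (hn : n = n₀ + k * l) (h0 : l = 0 → K.indepNum = n₀ - k) :
    InClass n (n - k) (attach K (C : Set V) l) := by
  -- For `l = 0` there is no new pendant vertex to match with, so the independence number comes from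
  -- `h0`.
  rcases Nat.eq_zero_or_pos l with rfl | hl
  · have : InClass n (n - k) K := ⟨hK, by omega, by rw [h0 rfl]; omega⟩
    exact this.congr (attachZeroIso K C).symm
  have hcard' : Fintype.card (V ⊕ (↥(↑C : Set V) × Fin l)) = n := by
    rw [Fintype.card_sum, Fintype.card_prod, hcard, Fintype.card_fin, hn, ← hC]
    simp
  refine ⟨attach_connected_iff.2 hK, hcard', ?_⟩
  have h := indepNum_eq_of_injOn (G := attach K (C : Set V) l)
    (C := C.map ⟨Sum.inl, Sum.inl_injective⟩) ?_
    (fun x => match x with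
      | Sum.inl v => if h : v ∈ C then Sum.inr (⟨v, h⟩, ⟨0, hl⟩) else Sum.inl v
      | Sum.inr y => Sum.inr y) ?_ ?_ ?_
  · rw [h, Finset.card_map, hcard', hC]
  · rintro (u | p) hu (v | q) hv h
    · exact hI u (by simpa using hu) v (by simpa using hv) h
    · have h' : u = q.1 := h
      exact hu (by simp [h'])
    · have h' : v = p.1 := h
      exact hv (by simp [h'])
    · exact h
  · rintro (u | p) hu (v | q) hv h
    · have hu' : u ∈ C := by simpa using hu
      have hv' : v ∈ C := by simpa using hv
      simpa [hu', hv'] using h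
    all_goals simp at hu hv
  · rintro (u | p) hu
    · have hu' : u ∈ C := by simpa using hu
      simp [hu']
    · simp at hu
  · rintro (u | p) hu
    · have hu' : u ∈ C := by simpa using hu
      simp only [hu', dite_true]
      exact rfl
    · simp at hu

theorem inClass_of_iso_attach {C : Finset V} {n n₀ k : ℕ} (hK : K.Connected)
    (hI : ∀ u ∉ C, ∀ v ∉ C, ¬ K.Adj u v) (hcard : Fintype.card V = n₀) (hC : #C = k)
    (hn : n = n₀ + k * l) (h0 : l = 0 → K.indepNum = n₀ - k) {W : Type*} [Fintype W]
    {T : SimpleGraph W} (e : T ≃g attach K (C : Set V) l) : InClass n (n - k) T :=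
  (inClass_attach hK hI hcard hC hn h0).congr e.symm

/-- If every vertex of `C` has at least `l` pendant neighbours, then `T` arises from a smaller graph
by attaching `l` pendant vertices to each vertex of `C`. -/
theorem exists_iso_attach {T : SimpleGraph V} {C : Finset V} {n₀ k : ℕ}
    (hp : ∀ v ∈ C, l ≤ #(pendants T C v)) (hC : #C = k) (hn : Fintype.card V = n₀ + k * l) :
    ∃ ι : Fin n₀ → V, Function.Injective ι ∧ #{x | ι x ∈ C} = k ∧
      Nonempty (T ≃g attach (T.comap ι) (↑({x | ι x ∈ C} : Finset (Fin n₀)) : Set (Fin n₀)) l) := by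
  have hg : ∀ v : C, ∃ g : Fin l → V, Function.Injective g ∧ ∀ j, g j ∈ pendants T C v := by
    intro v
    obtain ⟨t, ht, hcard⟩ := Finset.exists_subset_card_eq (hp v v.2)
    refine ⟨fun j => (t.equivFinOfCardEq hcard).symm j, fun i j h => ?_, fun j => ht ?_⟩
    · exact (t.equivFinOfCardEq hcard).symm.injective (Subtype.ext h)
    · exact ((t.equivFinOfCardEq hcard).symm j).2
  choose g hginj hgp using hg
  have hgC : ∀ v j, g v j ∉ C := fun v j => (Finset.mem_filter.1 (hgp v j)).2.1
  have hgadj : ∀ v j w, T.Adj (g v j) w ↔ w = v := fun v j => (Finset.mem_filter.1 (hgp v j)).2.2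
  have hginj' : Function.Injective fun p : C × Fin l => g p.1 p.2 := by
    rintro ⟨v, i⟩ ⟨w, j⟩ h
    have h1 : g v i = g w j := h
    have h2 : (v : V) = w := by rw [← hgadj w j, ← h1, hgadj]
    have h3 : v = w := Subtype.ext h2
    subst h3
    rw [hginj v h1]
  -- `R` consists of `l` chosen pendants at each vertex of `C`; the smaller graph is induced on the
  -- complement of `R`.
  set R : Finset V := univ.image fun p : C × Fin l => g p.1 p.2 with hR
  have hRcard : #R = k * l := by
    rw [hR, Finset.card_image_of_injective _ hginj']
    simp [hC]
  have hRc : #Rᶜ = n₀ := by rw [Finset.card_compl, hn, hRcard]; omega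
  set ε := (Rᶜ).equivFinOfCardEq hRc with hε
  set ι : Fin n₀ → V := fun j => ε.symm j with hι
  have hιinj : Function.Injective ι := fun i j h => ε.symm.injective (Subtype.ext h)
  have hιR : ∀ j, ι j ∉ R := fun j => Finset.mem_compl.1 (ε.symm j).2
  have hιsurj : ∀ v, v ∉ R → ∃ j, ι j = v := fun v hv =>
    ⟨ε ⟨v, Finset.mem_compl.2 hv⟩, by simp [hι]⟩
  have hRC : ∀ v ∈ C, v ∉ R := by
    intro v hv hvR
    obtain ⟨p, _, rfl⟩ := Finset.mem_image.1 hvR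
    exact hgC _ _ hv
  set C' : Finset (Fin n₀) := {x | ι x ∈ C} with hC'
  have hmem : ∀ x, x ∈ (C' : Set (Fin n₀)) ↔ ι x ∈ C := fun x => by simp [hC']
  refine ⟨ι, hιinj, ?_, ?_⟩
  · rw [← hC, ← Finset.card_image_of_injective C' hιinj]
    congr 1
    ext v
    simp only [Finset.mem_image]
    constructor
    · rintro ⟨x, hx, rfl⟩
      exact (hmem x).1 hx
    · intro hv
      obtain ⟨x, rfl⟩ := hιsurj v (hRC v hv)
      exact ⟨x, (hmem x).2 hv, rfl⟩
  · let ψ : Fin n₀ ⊕ (↥(↑C' : Set (Fin n₀)) × Fin l) → V :=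
      Sum.elim ι fun p => g ⟨ι p.1, (hmem _).1 p.1.2⟩ p.2
    have hψR : ∀ p, ψ (Sum.inr p) ∈ R := fun p =>
      Finset.mem_image.2 ⟨(⟨ι p.1, (hmem _).1 p.1.2⟩, p.2), Finset.mem_univ _, rfl⟩
    have hψ : Function.Bijective ψ := by
      constructor
      · rintro (x | p) (y | q) h
        · rw [hιinj h]
        · exact absurd (hψR q) (h ▸ hιR x)
        · exact absurd (hψR p) (h ▸ hιR y)
        · have := hginj' (a₁ := (⟨ι p.1, (hmem _).1 p.1.2⟩, p.2))
            (a₂ := (⟨ι q.1, (hmem _).1 q.1.2⟩, q.2)) h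
          simp only [Prod.mk.injEq, Subtype.mk.injEq] at this
          rw [Prod.ext (Subtype.ext (hιinj this.1)) this.2]
      · intro v
        by_cases hv : v ∈ R
        · obtain ⟨⟨w, j⟩, _, rfl⟩ := Finset.mem_image.1 hv
          obtain ⟨x, hx⟩ := hιsurj w (hRC w w.2)
          refine ⟨Sum.inr (⟨x, (hmem x).2 (hx ▸ w.2)⟩, j), ?_⟩
          have : (⟨ι x, hx ▸ w.2⟩ : C) = w := Subtype.ext hx
          simp only [ψ, Sum.elim_inr]
          rw [this]
        · obtain ⟨x, hx⟩ := hιsurj v hv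
          exact ⟨Sum.inl x, hx⟩
    refine ⟨SimpleGraph.Iso.symm ⟨Equiv.ofBijective ψ hψ, ?_⟩⟩
    rintro (x | p) (y | q)
    · exact Iff.rfl
    · change T.Adj (ι x) (g _ q.2) ↔ x = q.1
      rw [T.adj_comm, hgadj]
      exact hιinj.eq_iff
    · change T.Adj (g _ p.2) (ι y) ↔ y = p.1
      rw [hgadj]
      exact hιinj.eq_iff
    · change T.Adj (g _ p.2) (g _ q.2) ↔ False
      rw [hgadj, iff_false]
      intro h
      have hmem' := (hmem _).1 p.1.2
      exact hgC _ _ (by rw [h]; exact hmem')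

end Attach

/-! ### The arithmetic of `n₀` and the correspondence between minimizers and kernels. -/

section Kernel

/-- The value of `n₀` is what makes the degree bound `s` leave room for `l` pendants at every vertex
of `C`. -/
theorem exists_degree_bound {n k r n₀ l : ℕ} (hk : 1 ≤ k) (hr : r ≤ k - 1)
    (hn₀ : (n₀ : ℤ) = 3 * (k : ℤ) ^ 2 - k - 1 - (k - 1) * r) (hn : n = n₀ + k * l)
    (h1 : k = 1 → 2 ≤ n) :
    ∃ s : ℕ, (∃ G : SimpleGraph (Fin n), InClass n (n - k) G ∧ rho G < √(s + 1)) ∧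
      (k - 1) * s + k + l ≤ n ∧ (2 ≤ k → 3 * k + 2 ≤ n ∧ (k - 1) * s + 4 ≤ n) := by
  obtain ⟨m, rfl⟩ : ∃ m, k = m + 1 := ⟨k - 1, by omega⟩
  rw [Nat.add_sub_cancel] at hr
  have hrm : (r : ℤ) ≤ m := by exact_mod_cast hr
  have hr0 : (0 : ℤ) ≤ r := by positivity
  have hl0 : (0 : ℤ) ≤ l := by positivity
  have hm0 : (0 : ℤ) ≤ m := by positivity
  push_cast at hn₀
  have hnZ : (n : ℤ) = 3 * (m + 1) ^ 2 - (m + 1) - 1 - m * r + (m + 1) * l := by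
    rw [hn]; push_cast; rw [hn₀]; ring
  have hbig : 2 ≤ m + 1 → 3 * (m + 1) + 2 ≤ n := by
    intro hm
    have : (1 : ℤ) ≤ m := by omega
    zify
    rw [hnZ]
    nlinarith
  have hn3 : 3 ≤ n + 2 * (m + 1) := by
    rcases Nat.eq_zero_or_pos m with rfl | hm
    · have := h1 rfl; omega
    · omega
  set s := (n + 2 * (m + 1) - 3) / (m + 1) with hs
  set t := (n + 2 * (m + 1) - 3) % (m + 1) with ht
  have hst : (m + 1) * s + t + 3 = n + 2 * (m + 1) := by
    have := Nat.div_add_mod (n + 2 * (m + 1) - 3) (m + 1)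
    rw [← hs, ← ht] at this
    omega
  have htlt : t < m + 1 := Nat.mod_lt _ (by omega)
  -- `q` is the deviation of `s` from `3k + 1 - r + l`. It satisfies `k * q = r - 4 - t`, so `q ≤
  -- 0`, and the room left in the count is `-q * (k - 1)`.
  obtain ⟨q, hq⟩ : ∃ q : ℤ, (s : ℤ) = 3 * (m + 1) + 1 - r + l + q :=
    ⟨s - (3 * (m + 1) + 1 - r + l), by ring⟩
  have hstZ : ((m : ℤ) + 1) * s + t + 3 = n + 2 * (m + 1) := by exact_mod_cast hst
  have ht0 : (0 : ℤ) ≤ t := by positivity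
  have htZ : (t : ℤ) ≤ m := by omega
  have hkq : ((m : ℤ) + 1) * q = r - 4 - t := by
    rw [hq, hnZ] at hstZ
    linarith
  have hq0 : q ≤ 0 := by
    by_contra! h
    nlinarith
  have hslack : (n : ℤ) - (m * s + (m + 1) + l) = -q * m := by
    rw [hq] at hstZ ⊢
    linarith
  have hs2 : 2 * (m + 1) ≤ s + 1 := by
    rcases Nat.eq_zero_or_pos m with rfl | hm
    · have := h1 rfl
      omega
    · have : (1 : ℤ) ≤ m := by omega
      have hq2 : -2 ≤ q := by
        by_contra! h
        nlinarith
      zify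
      linarith
  refine ⟨s, exists_inClass_rho_lt (by omega) hst htlt hs2, ?_, fun hm => ⟨hbig hm, ?_⟩⟩
  · rw [Nat.add_sub_cancel]
    zify
    nlinarith
  · rw [Nat.add_sub_cancel]
    zify
    have hm1 : (1 : ℤ) ≤ m := by omega
    -- For `m ≥ 3` the sign of `q` suffices; for `m = 1, 2` the relation `hkq` forces `q ≤ -2` and
    -- `q ≤ -1` respectively.
    have hgoal : 0 ≤ -q * m + (m + 1) - 4 := by
      rcases (show (m : ℤ) = 1 ∨ m = 2 ∨ 3 ≤ (m : ℤ) by omega) with h | h | h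
      · rw [h] at hkq hrm htZ ⊢; omega
      · rw [h] at hkq hrm htZ ⊢; omega
      · nlinarith
    linarith

theorem isSubdividedTree_of_isMinimizer {n k r n₀ l : ℕ} (hk : 1 ≤ k) (hr : r ≤ k - 1)
    (hn₀ : (n₀ : ℤ) = 3 * (k : ℤ) ^ 2 - k - 1 - (k - 1) * r) (hn : n = n₀ + k * l)
    (h1 : k = 1 → 2 ≤ n) {V : Type*} [Fintype V] {T : SimpleGraph V}
    (hT : IsMinimizer n (n - k) T) {C : Finset V} (hC : #C = k)
    (hI : ∀ u ∉ C, ∀ v ∉ C, ¬ T.Adj u v) :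
    IsSubdividedTree T C ∧ (∀ v ∈ C, l ≤ #(pendants T C v)) ∧
      (2 ≤ k → 2 * k ≤ n ∧ evenVertices T = C) := by
  obtain ⟨s, hs, hks, hk2⟩ := exists_degree_bound hk hr hn₀ hn h1
  have h2n : 2 * k ≤ n := by
    rcases hk.eq_or_lt with h | h
    · have := h1 h.symm; omega
    · have := hk2 h; omega
  have hTC := hT.isSubdividedTree hs hk h2n (by omega) (fun h => (hk2 h).1) hC hI
  exact ⟨hTC, fun v hv => hT.le_card_pendants hs hks hC hI hv, fun h => ⟨h2n, evenVertices_eq hTC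
    (by omega) fun v hv => hT.three_le_degree hs (hk2 h).2 hC hI hv⟩⟩

theorem exists_compl_isIndepSet {V : Type*} [Fintype V] {T : SimpleGraph V} {n k : ℕ}
    (hT : InClass n (n - k) T) (hk : k ≤ n) :
    ∃ C : Finset V, #C = k ∧ ∀ u ∉ C, ∀ v ∉ C, ¬ T.Adj u v := by
  obtain ⟨I, hI⟩ := T.exists_isNIndepSet_indepNum
  refine ⟨Iᶜ, ?_, fun u hu v hv h => ?_⟩
  · rw [Finset.card_compl, hT.2.1, hI.card_eq, hT.2.2]
    omega
  · rw [Finset.mem_compl, not_not] at hu hv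
    exact hI.isIndepSet hu hv h.ne h

theorem evenVertices_eq_univ_of_subsingleton {V : Type*} [Subsingleton V] (K : SimpleGraph V) :
    evenVertices K = Set.univ := by
  ext x
  simp only [Set.mem_univ, iff_true]
  have hx : IsControlVertex K x := Or.inl fun w => Subsingleton.elim w x
  exact ⟨x, x, hx, hx, SimpleGraph.Walk.nil, SimpleGraph.Walk.IsPath.nil, 0, by simp⟩

variable {n k r n₀ l : ℕ}

theorem inClass_and_rho_of_iso_attach (hk : 1 ≤ k) (hr : r ≤ k - 1)
    (hn₀ : (n₀ : ℤ) = 3 * (k : ℤ) ^ 2 - k - 1 - (k - 1) * r) (hn : n = n₀ + k * l)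
    (h1 : k = 1 → 2 ≤ n) {K : SimpleGraph (Fin n₀)} (hK : IsKernel k n₀ K)
    {V : Type*} [Fintype V] {T : SimpleGraph V}
    (hT : Nonempty (T ≃g attach K (evenVertices K) l)) :
    InClass n (n - k) T ∧ rho T = √(rho K ^ 2 + l) := by
  obtain ⟨e⟩ := hT
  rcases hk.eq_or_lt with hk1 | hk2
  · obtain rfl := hk1.symm
    have hn1 : n₀ = 1 := by
      have : (r : ℤ) = 0 := by omega
      rw [this] at hn₀
      push_cast at hn₀
      omega
    subst hn1
    have hconn : K.Connected := SimpleGraph.IsTree.of_subsingleton.connected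
    have heven : evenVertices K = ((univ : Finset (Fin 1)) : Set (Fin 1)) := by
      rw [evenVertices_eq_univ_of_subsingleton, Finset.coe_univ]
    rw [heven] at e
    refine ⟨inClass_of_iso_attach hconn (by simp) (by simp) (by simp) hn (fun hl => ?_) e,
      rho_eq_of_iso_attach hconn (fun u v h => absurd (Subsingleton.elim u v) h.ne)
        (fun i hi => ?_) e⟩
    · have := h1 rfl
      rw [hl] at hn
      omega
    · exact absurd (Finset.mem_coe.2 (Finset.mem_univ i)) hi
  · have hKm : IsMinimizer n₀ (n₀ - k) K := hK.resolve_left fun h => by omega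
    have hkn : 2 * k ≤ n₀ := by
      obtain ⟨s, -, -, h⟩ := exists_degree_bound (l := 0) hk hr hn₀ rfl (by omega)
      have := (h hk2).1
      omega
    obtain ⟨C, hC, hI⟩ := exists_compl_isIndepSet hKm.1 (by omega)
    obtain ⟨hKC, -, h⟩ := isSubdividedTree_of_isMinimizer (l := 0) hk hr hn₀ rfl (by omega)
      hKm hC hI
    rw [(h hk2).2] at e
    have hnt : Nontrivial (Fin n₀) := Fin.nontrivial_iff_two_le.2 (by omega)
    refine ⟨inClass_of_iso_attach hKm.1.1 hI (by simp) hC hn (fun _ => hKm.1.2.2) e,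
      rho_eq_of_iso_attach hKm.1.1 (by simpa using hKC.mem_iff_of_adj) (fun i _ => ?_) e⟩
    have hd := hKm.1.1.preconnected.degree_pos_of_nontrivial i
    rw [SimpleGraph.degree_pos_iff_exists_adj] at hd
    exact hd

theorem IsKernel.rho_eq {K L : SimpleGraph (Fin n₀)} (hK : IsKernel k n₀ K)
    (hL : IsKernel k n₀ L) : rho K = rho L := by
  by_cases h : k = 1 ∧ n₀ = 1
  · obtain ⟨-, rfl⟩ := h
    rw [Subsingleton.elim K L]
  · have hK := hK.resolve_left h
    have hL := hL.resolve_left h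
    exact le_antisymm (hK.2 L hL.1) (hL.2 K hK.1)

theorem IsMinimizer.exists_kernel (hk : 1 ≤ k) (hr : r ≤ k - 1)
    (hn₀ : (n₀ : ℤ) = 3 * (k : ℤ) ^ 2 - k - 1 - (k - 1) * r) (hn : n = n₀ + k * l)
    (h1 : k = 1 → 2 ≤ n) {V : Type*} [Fintype V] {T : SimpleGraph V}
    (hT : IsMinimizer n (n - k) T) :
    ∃ K : SimpleGraph (Fin n₀), IsKernel k n₀ K ∧
      Nonempty (T ≃g attach K (evenVertices K) l) := by
  obtain ⟨s, -, hks, -⟩ := exists_degree_bound hk hr hn₀ hn h1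
  obtain ⟨C, hC, hI⟩ := exists_compl_isIndepSet hT.1 (by omega)
  obtain ⟨hTC, hp, -⟩ := isSubdividedTree_of_isMinimizer hk hr hn₀ hn h1 hT hC hI
  obtain ⟨ι, hι, hC', ⟨e⟩⟩ := exists_iso_attach hp hC (hT.1.2.1.trans hn)
  set C' : Finset (Fin n₀) := {x | ι x ∈ C} with hC'def
  set K := T.comap ι with hK
  have hmem : ∀ x, x ∈ C' ↔ ι x ∈ C := fun x => by simp [hC'def]
  rcases hk.eq_or_lt with hk1 | hk2
  · obtain rfl := hk1.symm
    have hn1 : n₀ = 1 := by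
      have : (r : ℤ) = 0 := by omega
      rw [this] at hn₀
      push_cast at hn₀
      omega
    subst hn1
    have hCu : C' = univ := Finset.eq_univ_of_card _ (by simpa using hC')
    refine ⟨K, Or.inl ⟨rfl, rfl⟩, ⟨?_⟩⟩
    rw [evenVertices_eq_univ_of_subsingleton, ← Finset.coe_univ, ← hCu]
    exact e
  · have hkn : 2 * k ≤ n₀ := by
      obtain ⟨s, -, -, h⟩ := exists_degree_bound (l := 0) hk hr hn₀ rfl (by omega)
      have := (h hk2).1
      omega
    have hconn : K.Connected := attach_connected_iff.1 (e.connected_iff.1 hT.1.1)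
    have hKC : IsSubdividedTree K C' := by
      refine ⟨⟨hconn, hTC.isTree.isAcyclic.comap (⟨ι, fun h => h⟩ : K →g T) hι⟩,
        fun u v h => ?_, fun i hi => ?_⟩
      · rw [hmem, hmem]
        exact hTC.mem_iff_of_adj _ _ h
      · refine le_trans ?_ (hTC.degree_le_two (ι i) (fun h => hi ((hmem i).2 h)))
        rw [← SimpleGraph.card_neighborFinset_eq_degree,
          ← SimpleGraph.card_neighborFinset_eq_degree, ← Finset.card_image_of_injective _ hι]
        refine Finset.card_le_card fun v hv => ?_
        obtain ⟨u, hu, rfl⟩ := Finset.mem_image.1 hv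
        rw [SimpleGraph.mem_neighborFinset] at hu ⊢
        exact hu
    have hKI : ∀ u ∉ C', ∀ v ∉ C', ¬ K.Adj u v := fun u hu v hv => by
      rw [hmem] at hu hv
      exact hI _ hu _ hv
    have hind : K.indepNum = n₀ - k := by
      rw [hKC.indepNum_eq (by omega) (by simp; omega), hC', Fintype.card_fin]
    have hKcl : InClass n₀ (n₀ - k) K := ⟨hconn, Fintype.card_fin _, hind⟩
    have hnt : Nontrivial (Fin n₀) := Fin.nontrivial_iff_two_le.2 (by omega)
    have hrho : rho T = √(rho K ^ 2 + l) := by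
      refine rho_eq_of_iso_attach hconn (fun u v h => ?_) (fun i _ => ?_) e
      · rw [Finset.mem_coe, Finset.mem_coe]
        exact hKC.mem_iff_of_adj u v h
      have hd := hconn.preconnected.degree_pos_of_nontrivial i
      rw [SimpleGraph.degree_pos_iff_exists_adj] at hd
      exact hd
    -- Attaching `l` pendants at each even vertex of a minimizer `L` of order `n₀` gives a
    -- competitor of `T`; cancelling `l` under the square roots yields `rho K ≤ rho L`.
    have hmin : IsMinimizer n₀ (n₀ - k) K := by
      obtain ⟨L, hL⟩ := exists_isMinimizer hKcl
      have hLa := inClass_and_rho_of_iso_attach hk hr hn₀ hn h1 (Or.inr hL)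
        ⟨SimpleGraph.Iso.refl (G := attach L (evenVertices L) l)⟩
      have hle := hT.le_rho hLa.1
      have hne : Nonempty (Fin n₀) := hconn.nonempty
      rw [hrho, hLa.2, Real.sqrt_le_sqrt_iff (by positivity), add_le_add_iff_right,
        sq_le_sq₀ (rho_nonneg K) (rho_nonneg L)] at hle
      exact ⟨hKcl, fun G hG => hle.trans (hL.2 G hG)⟩
    obtain ⟨-, -, h⟩ := isSubdividedTree_of_isMinimizer (l := 0) hk hr hn₀ rfl (by omega)
      hmin hC' hKI
    refine ⟨K, Or.inr hmin, ⟨?_⟩⟩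
    rw [(h hk2).2]
    exact e

end Kernel

end IndepMinimizer

theorem theorem4p1 (n α k r n₀ : ℕ) (hk : 1 ≤ k) (hα : α + k = n) (hkn : 2 * k ≤ n)
    (hr : r ≤ k - 1) (hmod : n + 1 ≡ r [MOD k])
    (hn₀ : (n₀ : ℤ) = 3 * (k : ℤ) ^ 2 - k - 1 - (k - 1) * r) (hn : n₀ ≤ n) :
    k ∣ n - n₀ ∧
    ∀ {V : Type*} [Fintype V] (T : SimpleGraph V),
      (IndepMinimizer.IsMinimizer n α T ↔
        ∃ K : SimpleGraph (Fin n₀), IndepMinimizer.IsKernel k n₀ K ∧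
          Nonempty (T ≃g IndepMinimizer.attach K (IndepMinimizer.evenVertices K) ((n - n₀) / k))) ∧
      ∀ K : SimpleGraph (Fin n₀), IndepMinimizer.IsKernel k n₀ K →
        Nonempty (T ≃g IndepMinimizer.attach K (IndepMinimizer.evenVertices K) ((n - n₀) / k)) →
          IndepMinimizer.rho T =
            Real.sqrt (IndepMinimizer.rho K ^ 2 + (((n - n₀) / k : ℕ) : ℝ)) := by
  have hdvd : k ∣ n - n₀ := by
    have h1 := Nat.modEq_iff_dvd.1 hmod
    zify [hn]
    -- Modulo `k`, `n₀` is congruent to `r - 1`.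
    have h2 : (n : ℤ) - n₀ = -((r : ℤ) - ((n + 1 : ℕ) : ℤ)) - k * (3 * k - 1 - r) := by
      rw [hn₀]; push_cast; ring
    rw [h2]
    exact dvd_sub (dvd_neg.2 h1) (dvd_mul_right _ _)
  refine ⟨hdvd, fun {V} _ T => ?_⟩
  set l := (n - n₀) / k with hl
  have hnl : n = n₀ + k * l := by
    have := Nat.mul_div_cancel' hdvd
    rw [← hl] at this
    omega
  have h1 : k = 1 → 2 ≤ n := fun h => by omega
  obtain rfl : α = n - k := by omega
  refine ⟨⟨fun hT => hT.exists_kernel hk hr hn₀ hnl h1, ?_⟩, fun K hK hT =>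
    (IndepMinimizer.inClass_and_rho_of_iso_attach hk hr hn₀ hnl h1 hK hT).2⟩
  rintro ⟨K, hK, hT⟩
  obtain ⟨hcl, hrho⟩ := IndepMinimizer.inClass_and_rho_of_iso_attach hk hr hn₀ hnl h1 hK hT
  refine ⟨hcl, fun G hG => ?_⟩
  -- Some minimizer `S` also comes from a kernel, and all kernels share one spectral radius, so `T`
  -- and `S` do too.
  obtain ⟨S, hS⟩ := IndepMinimizer.exists_isMinimizer hG
  obtain ⟨L, hL, hSL⟩ := hS.exists_kernel hk hr hn₀ hnl h1
  rw [hrho, hK.rho_eq hL,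
    ← (IndepMinimizer.inClass_and_rho_of_iso_attach hk hr hn₀ hnl h1 hL hSL).2]
  exact hS.2 G hG
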